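/- Fix $n \ge 1$ agents and $m \ge 0$ indivisible goods, and let $v_{i,j} \in \mathbb{Z}_{\ge 0}$ be the value of agent $i$ for good $j$. Valuations are additive: $v_i(S) = \sum_{j \in S} v_{i,j}$ for every set $S$ of goods. Put $v_{\max} = \max_{i,j} v_{i,j}$ ($=0$ if $m=0$). An allocation is an ordered partition $x = (x_1, \dots, x_n)$ of the set of all goods into $n$ possibly empty bundles. It is \emph{envy-free up to one good} (EF1) if for all agents $i, k$ with $x_k \neq \emptyset$ there is a good $j \in x_k$ with $v_i(x_i) \ge v_i(x_k \setminus \{j\})$. It is \emph{Pareto optimal} (PO) if there is no allocation $y$ with $v_k(y_k) \ge v_k(x_k)$ for every agent $k$ and $v_i(y_i) > v_i(x_i)$ for some agent $i$. \textbf{Theorem.} There is a single deterministic algorithm (a random access machine program whose running time is measured by the logarithmic cost criterion, the instance being given by $n$, $m$ and the matrix $(v_{i,j})$) which, on every such instance, halts and outputs an allocation that is both EF1 and PO, in time at most $p(m, n, v_{\max})$, where $p$ is a polynomial that does not depend on the instance. Consequently, for polynomially bounded valuations this algorithm runs in polynomial time: for every polynomial $f$ with nonnegative integer coefficients there is a polynomial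 $q$ such that on every instance with $v_{i,j} \le f(m,n)$ for all $i,j$ the algorithm halts and outputs such an allocation in time at most $q(m,n)$. -/

import Mathlib

namespace FairDivision

/-! ### Fair division of indivisible goods -/

/-- The additive valuation of agent `i` for a set `S` of goods, where `v i j` is the value of
agent `i` for the single good `j`. -/
def value {n m : ℕ} (v : Fin n → Fin m → ℕ) (i : Fin n) (S : Finset (Fin m)) : ℕ :=
  ∑ j ∈ S, v i j

/-- The maximum of all the entries `v i j` (it is `0` if there are no goods). -/
def vmax {n m : ℕ} (v : Fin n → Fin m → ℕ) : ℕ :=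
  Finset.univ.sup fun p : Fin n × Fin m => v p.1 p.2

/-- An (integral) allocation of all the goods, that is, an ordered partition of the goods into `n`
possibly empty bundles, given by the owner of each good. -/
abbrev Allocation (n m : ℕ) : Type := Fin m → Fin n

/-- The bundle of goods that agent `i` receives. -/
def bundle {n m : ℕ} (x : Allocation n m) (i : Fin n) : Finset (Fin m) :=
  Finset.univ.filter fun j => x j = i

/-- Envy-freeness up to one good. An empty bundle is envied by nobody. -/
def IsEF1 {n m : ℕ} (v : Fin n → Fin m → ℕ) (x : Allocation n m) : Prop :=
  ∀ i k : Fin n, (bundle x k).Nonempty →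
    ∃ j ∈ bundle x k, value v i ((bundle x k).erase j) ≤ value v i (bundle x i)

/-- The allocation `y` Pareto dominates the allocation `x`. -/
def ParetoDominates {n m : ℕ} (v : Fin n → Fin m → ℕ) (y x : Allocation n m) : Prop :=
  (∀ k, value v k (bundle x k) ≤ value v k (bundle y k)) ∧
    ∃ i, value v i (bundle x i) < value v i (bundle y i)

/-- Pareto optimality among the integral allocations. -/
def IsPO {n m : ℕ} (v : Fin n → Fin m → ℕ) (x : Allocation n m) : Prop :=
  ∀ y : Allocation n m, ¬ ParetoDominates v y x

/-! ### Random access machines with logarithmic cost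

Programs are structured (assignments, conditionals, loops) and work on a random access memory that
consists of arrays of natural numbers. A program names its arrays by fixed numbers, so it uses
finitely many of them; the positions within an array are computed, which is indirect addressing.
The time is measured by the logarithmic cost criterion: handling a number costs its length in
binary, so that arithmetic on long numbers is not free. -/

/-- The memory: `s a k` is the content of cell `k` of array `a`. -/
abbrev Memory : Type := ℕ → ℕ → ℕ

/-- Arithmetic expressions; `read a e` is the content of the cell of array `a` whose position is
the value of `e`. -/
inductive Expr : Type
  | lit (c : ℕ) : Expr
  | read (a : ℕ) (e : Expr) : Expr
  | add (e f : Expr) : Expr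
  | sub (e f : Expr) : Expr
  | mul (e f : Expr) : Expr
  | div (e f : Expr) : Expr

/-- The value of an expression (subtraction is cut off at `0`, division is rounded down). -/
def Expr.eval (s : Memory) : Expr → ℕ
  | .lit c => c
  | .read a e => s a (e.eval s)
  | .add e f => e.eval s + f.eval s
  | .sub e f => e.eval s - f.eval s
  | .mul e f => e.eval s * f.eval s
  | .div e f => e.eval s / f.eval s

/-- The cost of evaluating an expression: each operation costs one unit plus the number of binary
digits of its result. -/
def Expr.cost (s : Memory) : Expr → ℕ
  | .lit c => 1 + c.size
  | .read a e => e.cost s + (1 + (s a (e.eval s)).size)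
  | .add e f => e.cost s + f.cost s + (1 + (e.eval s + f.eval s).size)
  | .sub e f => e.cost s + f.cost s + (1 + (e.eval s - f.eval s).size)
  | .mul e f => e.cost s + f.cost s + (1 + (e.eval s * f.eval s).size)
  | .div e f => e.cost s + f.cost s + (1 + (e.eval s / f.eval s).size)

/-- Programs. A condition holds if its value is nonzero. -/
inductive Program : Type
  | skip : Program
  | assign (a : ℕ) (pos val : Expr) : Program
  | seq (P Q : Program) : Program
  | branch (cond : Expr) (P Q : Program) : Program
  | loop (cond : Expr) (P : Program) : Program

/-- The memory after `w` has been written into cell `k` of array `a`. -/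
def Memory.write (s : Memory) (a k w : ℕ) : Memory :=
  Function.update s a (Function.update (s a) k w)

/-- `Runs P s t s'`: the program `P`, started on the memory `s`, halts after time exactly `t`, with
memory `s'`. -/
inductive Runs : Program → Memory → ℕ → Memory → Prop
  | skip (s : Memory) : Runs .skip s 1 s
  | assign (a : ℕ) (pos val : Expr) (s : Memory) :
      Runs (.assign a pos val) s (1 + pos.cost s + val.cost s)
        (s.write a (pos.eval s) (val.eval s))
  | seq {P Q : Program} {s s' s'' : Memory} {t u : ℕ} :
      Runs P s t s' → Runs Q s' u s'' → Runs (.seq P Q) s (t + u) s''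
  | branch_true {cond : Expr} {P Q : Program} {s s' : Memory} {t : ℕ} :
      cond.eval s ≠ 0 → Runs P s t s' → Runs (.branch cond P Q) s (1 + cond.cost s + t) s'
  | branch_false {cond : Expr} {P Q : Program} {s s' : Memory} {t : ℕ} :
      cond.eval s = 0 → Runs Q s t s' → Runs (.branch cond P Q) s (1 + cond.cost s + t) s'
  | loop_stop {cond : Expr} {P : Program} {s : Memory} :
      cond.eval s = 0 → Runs (.loop cond P) s (1 + cond.cost s) s
  | loop_step {cond : Expr} {P : Program} {s s' s'' : Memory} {t u : ℕ} :
      cond.eval s ≠ 0 → Runs P s t s' → Runs (.loop cond P) s' u s'' →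
        Runs (.loop cond P) s (1 + cond.cost s + t + u) s''

/-- The memory that presents an instance: array `0` holds `n` and `m` in its first two cells, array
`1` holds the valuation matrix row by row (`v i j` stands in cell `i * m + j`, with agents and goods
counted from `0`), and all other cells are `0`. -/
def inputMemory {n m : ℕ} (v : Fin n → Fin m → ℕ) : Memory := fun a k =>
  if a = 0 then (if k = 0 then n else if k = 1 then m else 0)
  else if a = 1 then
    (if h : k < n * m then
      v ⟨k / m, Nat.div_lt_of_lt_mul (by rwa [Nat.mul_comm] at h)⟩
        ⟨k % m, Nat.mod_lt k (Nat.pos_of_ne_zero fun hm => by simp [hm] at h)⟩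
    else 0)
  else 0

/-- `Outputs P v t x`: on the instance `v`, the program `P` halts after time exactly `t` and then
the first `m` cells of array `2` list the owners of the goods in the allocation `x`. -/
def Outputs {n m : ℕ} (P : Program) (v : Fin n → Fin m → ℕ) (t : ℕ) (x : Allocation n m) : Prop :=
  ∃ s : Memory, Runs P (inputMemory v) t s ∧ ∀ j : Fin m, s 2 j = x j

end FairDivision

/-! The proof is a market argument with integer logarithms. Let agent `i` have weight `w i = θ ^ f
i`, where `θ = 1 + 1 / K`. If every good goes to an agent for whom weight times value is largest, a
weighted welfare with positive weights is maximal, so the allocation is PO. If moreover every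
nonempty bundle has a good whose removal brings its owner's spending (weight times wealth) down to
at most the least spending, the allocation is EF1: for the rest `S` of the bundle of `k`, `w i *
v_i(S) ≤ w k * v_k(S)`, which is at most the spending of `i`. Logarithms to the base `θ` are rounded
down, which costs factors `θ`. Values are integers, so with `U = m * vmax v + 1` and `K = 4 * U ^ 2`
the losses stay below the one unit that a Pareto improvement must gain, and below the one unit of
endowment that gives slack for EF1 (`Valid.isPO`, `Valid.isEF1`).

The state is an allocation, the exponents `f` and a lower bound `σ` for the logarithms of the
spendings. A breadth-first search starts at the agents with spending `σ` and passes from an agent to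
the owner of any good for which the agent ties with the owner. Either some good can move nearer to
the poorest agents (`Valid.move`), or all agents are reached and the allocation is fair
(`fair_of_stuck`), or `σ` and the weights of the reached agents go up by one step (`Valid.raise`).
Moves decrease `potential`; raises increase `∑ i, (σ - f i)`, which never exceeds `n * (K * U)`.
Hence there are polynomially many iterations in `n`, `m`, `U`.

For the machine, `Achieves` is a total-correctness predicate that measures time in units of `L + 1`,
where all cells have at most `L` digits. The time bounds are expressions over an arbitrary
commutative semiring, so that the same expression, read in a polynomial ring, is the required
polynomial (`map_fairTime`). -/

namespace FairDivision

/-! ### Weighted welfare with rounded logarithms -/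

section Market

variable {n m : ℕ}

/-- `lam` rounds down the logarithm to the base `1 + 1 / K` of every positive `t ≤ U`. -/
def IsLogTable (K U : ℕ) (lam : ℕ → ℕ) : Prop :=
  ∀ t, 0 < t → t ≤ U →
    (K + 1) ^ lam t ≤ t * K ^ lam t ∧ t * K ^ (lam t + 1) < (K + 1) ^ (lam t + 1)

/-- The value of agent `i` for its own bundle, plus an endowment of one unit. -/
def wealth (v : Fin n → Fin m → ℕ) (x : Allocation n m) (i : Fin n) : ℕ :=
  value v i (bundle x i) + 1

/-- The logarithm of what agent `a`, whose weight has logarithm `f a`, offers for good `j`. -/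
def bid (v : Fin n → Fin m → ℕ) (lam : ℕ → ℕ) (f : Fin n → ℕ) (a : Fin n) (j : Fin m) : ℕ :=
  f a + lam (v a j)

/-- Agent `a` offers for good `j` at least as much as its owner. -/
def Tight (v : Fin n → Fin m → ℕ) (lam : ℕ → ℕ) (x : Allocation n m) (f : Fin n → ℕ)
    (a : Fin n) (j : Fin m) : Prop :=
  0 < v a j ∧ bid v lam f (x j) j ≤ bid v lam f a j

/-- No agent offers more for a good than its owner. -/
def Feasible (v : Fin n → Fin m → ℕ) (lam : ℕ → ℕ) (x : Allocation n m) (f : Fin n → ℕ) : Prop :=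
  ∀ a j, 0 < v a j → 0 < v (x j) j ∧ bid v lam f a j ≤ bid v lam f (x j) j

/-- The invariant of the algorithm in the state `(x, f, σ)`. -/
structure Valid (v : Fin n → Fin m → ℕ) (lam : ℕ → ℕ) (x : Allocation n m) (f : Fin n → ℕ)
    (σ : ℕ) : Prop where
  feasible : Feasible v lam x f
  le_spending : ∀ i, σ ≤ f i + lam (wealth v x i)
  weight_le : ∀ i, f i ≤ σ
  -- A raise adds one to `σ` and at least one to the sum, so this persists; it turns the bound
  -- `Valid.sum_le` on the sum into a bound on `σ`.
  le_sum : σ ≤ ∑ i, (σ - f i)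

lemma le_vmax (v : Fin n → Fin m → ℕ) (i : Fin n) (j : Fin m) : v i j ≤ vmax v :=
  Finset.le_sup (f := fun p : Fin n × Fin m => v p.1 p.2) (Finset.mem_univ (i, j))

lemma value_le (v : Fin n → Fin m → ℕ) (i : Fin n) (S : Finset (Fin m)) :
    value v i S ≤ m * vmax v := by
  refine (Finset.sum_le_card_nsmul S _ (vmax v) fun j _ => le_vmax v i j).trans ?_
  have : S.card ≤ m := by simpa using Finset.card_le_univ S
  simpa using Nat.mul_le_mul_right _ this

lemma wealth_le (v : Fin n → Fin m → ℕ) (x : Allocation n m) (i : Fin n) :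
    wealth v x i ≤ m * vmax v + 1 :=
  Nat.succ_le_succ (value_le v i _)

lemma entry_le (v : Fin n → Fin m → ℕ) (i : Fin n) (j : Fin m) : v i j ≤ m * vmax v + 1 :=
  (le_vmax v i j).trans <|
    (Nat.le_mul_of_pos_left _ (Nat.pos_of_ne_zero fun h => by subst h; exact j.elim0)).trans
      (Nat.le_succ _)

lemma wealth_sub (v : Fin n → Fin m → ℕ) (x : Allocation n m) (j : Fin m) :
    wealth v x (x j) - v (x j) j = value v (x j) ((bundle x (x j)).erase j) + 1 := by
  have h : j ∈ bundle x (x j) := by simp [bundle]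
  have := Finset.add_sum_erase (bundle x (x j)) (fun j' => v (x j) j') h
  simp only [wealth, value] at this ⊢
  omega

/-- Bernoulli's inequality: `1 + e / K ≤ (1 + 1 / K) ^ e ≤ t`. -/
lemma exponent_le {K t e : ℕ} (hK : 0 < K) (h : (K + 1) ^ e ≤ t * K ^ e) : e ≤ K * t := by
  have hK' : (0 : ℝ) < K := by exact_mod_cast hK
  have h1 : ((K : ℝ) + 1) ^ e ≤ t * (K : ℝ) ^ e := by exact_mod_cast h
  have h2 := one_add_mul_le_pow (a := (1 / K : ℝ)) (by have := one_div_pos.2 hK'; linarith) e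
  have h3 : (1 + 1 / K : ℝ) ^ e ≤ t := by
    rw [show (1 + 1 / K : ℝ) = (K + 1) / K by field_simp, div_pow, div_le_iff₀ (by positivity)]
    exact h1
  have h4 : (e : ℝ) * (1 / K) ≤ t := by linarith
  rw [mul_one_div, div_le_iff₀ hK'] at h4
  have h5 : (e : ℝ) ≤ K * t := by linarith
  exact_mod_cast h5

namespace IsLogTable

variable {K U : ℕ} {lam : ℕ → ℕ}

lemma pow_le (h : IsLogTable K U lam) (hK : 0 < K) {t : ℕ} (ht : 0 < t) (htU : t ≤ U) :
    (1 + 1 / K : ℝ) ^ lam t ≤ t := by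
  have h1 := (h t ht htU).1
  have hK' : (0 : ℝ) < K := by exact_mod_cast hK
  have : (1 + 1 / K : ℝ) = (K + 1) / K := by field_simp
  rw [this, div_pow, div_le_iff₀ (by positivity)]
  exact_mod_cast h1

lemma lt_pow (h : IsLogTable K U lam) (hK : 0 < K) {t : ℕ} (ht : 0 < t) (htU : t ≤ U) :
    (t : ℝ) < (1 + 1 / K : ℝ) ^ (lam t + 1) := by
  have h1 := (h t ht htU).2
  have hK' : (0 : ℝ) < K := by exact_mod_cast hK
  have : (1 + 1 / K : ℝ) = (K + 1) / K := by field_simp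
  rw [this, div_pow, lt_div_iff₀ (by positivity)]
  exact_mod_cast h1

lemma mono (h : IsLogTable K U lam) (hK : 0 < K) {t t' : ℕ} (ht : 0 < t) (htt : t ≤ t')
    (htU : t' ≤ U) : lam t ≤ lam t' := by
  have h1 := h.pow_le hK ht (htt.trans htU)
  have h2 := h.lt_pow hK (ht.trans_le htt) htU
  have h3 : (t : ℝ) ≤ t' := by exact_mod_cast htt
  have hK' : (0 : ℝ) < K := by exact_mod_cast hK
  have h4 : (1 : ℝ) < 1 + 1 / K := by simp [hK]
  have := (pow_lt_pow_iff_right₀ h4).1 (h1.trans_lt (h3.trans_lt h2))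
  omega

lemma le_mul (h : IsLogTable K U lam) (hK : 0 < K) {t : ℕ} (ht : 0 < t) (htU : t ≤ U) :
    lam t ≤ K * U :=
  (exponent_le hK (h t ht htU).1).trans (Nat.mul_le_mul_left K htU)

end IsLogTable

/-- Regrouping by goods lets two welfares be compared good by good, which is where feasibility
applies. -/
lemma sum_weight_value (v : Fin n → Fin m → ℕ) (y : Allocation n m) (w : Fin n → ℝ) :
    ∑ i, w i * value v i (bundle y i) = ∑ j, w (y j) * v (y j) j := by
  have h := Finset.sum_fiberwise (s := Finset.univ) (g := y)
    (f := fun j => w (y j) * (v (y j) j : ℝ))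
  rw [← h]
  refine Finset.sum_congr rfl fun i _ => ?_
  simp only [value, bundle, Nat.cast_sum, Finset.mul_sum]
  refine Finset.sum_congr rfl fun j hj => ?_
  rw [(Finset.mem_filter.1 hj).2]

/-! ### Rounded optimality implies PO and EF1 -/

section Final

variable {v : Fin n → Fin m → ℕ} {lam : ℕ → ℕ} {x : Allocation n m} {f : Fin n → ℕ} {σ K U : ℕ}

/-- Only the upper bound on `v a j` pays a factor `θ` for rounding; the lower bound on the owner's
value is free. -/
lemma Feasible.weight_mul_le (hx : Feasible v lam x f) (h : IsLogTable K (m * vmax v + 1) lam)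
    (hK : 0 < K) (a : Fin n) (j : Fin m) :
    (1 + 1 / K : ℝ) ^ f a * v a j ≤
      (1 + 1 / K) * ((1 + 1 / K : ℝ) ^ f (x j) * v (x j) j) := by
  have hK' : (0 : ℝ) < K := by exact_mod_cast hK
  have h0 : (1 : ℝ) ≤ 1 + 1 / K := by simp
  rcases Nat.eq_zero_or_pos (v a j) with h1 | h1
  · rw [h1]; simp only [Nat.cast_zero, mul_zero]; positivity
  · obtain ⟨h2, h3⟩ := hx a j h1
    have h4 := h.lt_pow hK h1 (entry_le v a j)
    have h5 := h.pow_le hK h2 (entry_le v (x j) j)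
    have h6 := pow_le_pow_right₀ h0 h3
    unfold bid at h6
    calc (1 + 1 / K : ℝ) ^ f a * v a j
        ≤ (1 + 1 / K : ℝ) ^ f a * (1 + 1 / K : ℝ) ^ (lam (v a j) + 1) := by gcongr
      _ = (1 + 1 / K) * (1 + 1 / K : ℝ) ^ (f a + lam (v a j)) := by ring
      _ ≤ (1 + 1 / K) * (1 + 1 / K : ℝ) ^ (f (x j) + lam (v (x j) j)) := by gcongr
      _ = (1 + 1 / K) * ((1 + 1 / K : ℝ) ^ f (x j) * (1 + 1 / K : ℝ) ^ lam (v (x j) j)) := by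
        ring
      _ ≤ _ := by gcongr

/-- The exponent `σ` separates the weights from the spendings: `θ ^ f i ≤ θ ^ σ`, which is at most
the spending of `k`. -/
lemma Valid.weight_le_mul (hx : Valid v lam x f σ) (h : IsLogTable K (m * vmax v + 1) lam)
    (hK : 0 < K) (i k : Fin n) :
    (1 + 1 / K : ℝ) ^ f i ≤ (1 + 1 / K : ℝ) ^ f k * (m * vmax v + 1) := by
  have h0 : (1 : ℝ) ≤ 1 + 1 / K := by simp
  calc (1 + 1 / K : ℝ) ^ f i ≤ (1 + 1 / K : ℝ) ^ (f k + lam (wealth v x k)) :=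
        pow_le_pow_right₀ h0 ((hx.weight_le i).trans (hx.le_spending k))
    _ = (1 + 1 / K : ℝ) ^ f k * (1 + 1 / K : ℝ) ^ lam (wealth v x k) := by ring
    _ ≤ (1 + 1 / K : ℝ) ^ f k * wealth v x k := by
      gcongr
      exact h.pow_le hK (Nat.succ_pos _) (wealth_le v x k)
    _ ≤ _ := by
      gcongr
      exact_mod_cast wealth_le v x k

/-- By integrality a dominating allocation gains at least `w i` in weighted welfare. Feasibility
allows a gain of at most `1 / K` times the welfare of `x`, and that welfare is at most `w i * U ^ 2
= w i * K / 4`. -/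
theorem Valid.isPO (hx : Valid v lam x f σ)
    (h : IsLogTable (4 * (m * vmax v + 1) ^ 2) (m * vmax v + 1) lam) : IsPO v x := by
  rintro y ⟨h1, i, h2⟩
  set U := m * vmax v + 1 with hU
  set K := 4 * U ^ 2 with hKdef
  have hK : 0 < K := by positivity
  have hK' : (0 : ℝ) < K := by exact_mod_cast hK
  set w : Fin n → ℝ := fun i => (1 + 1 / K : ℝ) ^ f i with hw
  have hwpos : ∀ i, 0 < w i := fun i => by positivity
  have h3 : ∑ k, w k * value v k (bundle x k) + w i ≤ ∑ k, w k * value v k (bundle y k) := by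
    have h4 : ∀ k, w k * value v k (bundle x k) + (if k = i then w i else 0) ≤
        w k * value v k (bundle y k) := by
      intro k
      split_ifs with hk
      · subst hk
        have : (value v k (bundle x k) : ℝ) + 1 ≤ value v k (bundle y k) := by exact_mod_cast h2
        nlinarith [hwpos k]
      · have : (value v k (bundle x k) : ℝ) ≤ value v k (bundle y k) := by exact_mod_cast h1 k
        rw [add_zero]
        exact mul_le_mul_of_nonneg_left this (hwpos k).le
    have h5 := Finset.sum_le_sum (s := Finset.univ) fun k _ => h4 k
    rw [Finset.sum_add_distrib] at h5
    simpa using h5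
  rw [sum_weight_value, sum_weight_value] at h3
  have h6 : ∑ j, w (y j) * v (y j) j ≤ (1 + 1 / K) * ∑ j, w (x j) * v (x j) j := by
    rw [Finset.mul_sum]
    exact Finset.sum_le_sum fun j _ => hx.feasible.weight_mul_le h hK (y j) j
  have h7 : ∑ j, w (x j) * v (x j) j ≤ m * ((w i * U) * vmax v) := by
    have h8 : ∀ j ∈ (Finset.univ : Finset (Fin m)), w (x j) * v (x j) j ≤ (w i * U) * vmax v := by
      intro j _
      have := hx.weight_le_mul h hK (x j) i
      have h9 : (v (x j) j : ℝ) ≤ vmax v := by exact_mod_cast le_vmax v _ _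
      have h10 : w (x j) ≤ w i * U := by rw [hU]; push_cast; exact this
      have := hwpos (x j)
      gcongr
    simpa using Finset.sum_le_card_nsmul _ _ _ h8
  have h8 : w i * K ≤ ∑ j, w (x j) * v (x j) j := by
    have : w i ≤ (1 / K : ℝ) * ∑ j, w (x j) * v (x j) j := by linarith
    rw [one_div, inv_mul_eq_div, le_div_iff₀ hK'] at this
    exact this
  have h9 : (m : ℝ) * vmax v ≤ U := by rw [hU]; push_cast; linarith
  have h10 : (1 : ℝ) ≤ U := by rw [hU]; push_cast; have : (0 : ℝ) ≤ m * vmax v := by positivity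
                               linarith
  have h11 : (m : ℝ) * ((w i * U) * vmax v) ≤ w i * U ^ 2 := by
    calc (m : ℝ) * ((w i * U) * vmax v) = w i * U * (m * vmax v) := by ring
      _ ≤ w i * U * U := by have := hwpos i; gcongr
      _ = _ := by ring
  have h12 : w i * K = 4 * (w i * U ^ 2) := by rw [hKdef]; push_cast; ring
  have h13 : 0 < w i * (U : ℝ) ^ 2 := by have := hwpos i; positivity
  linarith

/-- If `i` envied the rest `S` of the bundle of `k`, the chain `w k * (v_k(S) + 1) ≤ θ * w i *
wealth_i`, `wealth_i ≤ v_i(S)`, `w i * v_i(S) ≤ θ * w k * v_k(S)` would close up to rounding. The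
endowment leaves `θ * w k` over, while rounding covers only `(θ ^ 2 - 1) * w i * U ≤ (3 / 4) * w k`.
-/
theorem Valid.isEF1 (hx : Valid v lam x f σ)
    (h : IsLogTable (4 * (m * vmax v + 1) ^ 2) (m * vmax v + 1) lam)
    (hfair : ∀ k, (bundle x k).Nonempty →
      ∃ j ∈ bundle x k, f k + lam (wealth v x k - v k j) ≤ σ) : IsEF1 v x := by
  intro i k hne
  obtain ⟨j, hj, hjσ⟩ := hfair k hne
  refine ⟨j, hj, ?_⟩
  obtain rfl : x j = k := (Finset.mem_filter.1 hj).2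
  rw [wealth_sub] at hjσ
  by_contra! hlt
  set k := x j with hk
  set U := m * vmax v + 1 with hU
  set K := 4 * U ^ 2 with hKdef
  have hK : 0 < K := by positivity
  have hK' : (0 : ℝ) < K := by exact_mod_cast hK
  have hθ : (1 : ℝ) ≤ 1 + 1 / K := by simp
  set θ : ℝ := 1 + 1 / K with hθdef
  set S := (bundle x k).erase j with hS
  have hwi : 0 < θ ^ f i := by positivity
  have hwk : 0 < θ ^ f k := by positivity
  have h1 : θ ^ f i * value v i S ≤ θ * (θ ^ f k * value v k S) := by
    simp only [value, Nat.cast_sum, Finset.mul_sum]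
    refine Finset.sum_le_sum fun j' hj' => ?_
    have := hx.feasible.weight_mul_le h hK i j'
    rwa [show x j' = k from (Finset.mem_filter.1 (Finset.mem_of_mem_erase hj')).2] at this
  have h2 : θ ^ f k * (value v k S + 1) ≤ θ * (θ ^ f i * wealth v x i) := by
    have h3 := (h.lt_pow hK (Nat.succ_pos (value v k S))
      (Nat.succ_le_succ (value_le v k S))).le
    have h4 := h.pow_le (t := wealth v x i) hK (Nat.succ_pos _) (wealth_le v x i)
    push_cast at h3
    calc θ ^ f k * (value v k S + 1) ≤ θ ^ f k * θ ^ (lam (value v k S + 1) + 1) := by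
          gcongr
      _ = θ * θ ^ (f k + lam (value v k S + 1)) := by ring
      _ ≤ θ * θ ^ (f i + lam (wealth v x i)) := by
        have := pow_le_pow_right₀ hθ (hjσ.trans (hx.le_spending i))
        gcongr
      _ = θ * (θ ^ f i * θ ^ lam (wealth v x i)) := by ring
      _ ≤ _ := by gcongr
  have h3 : θ ^ f i ≤ θ ^ f k * U := by
    have := hx.weight_le_mul h hK i k
    rw [hU]; push_cast; exact this
  -- Strict envy between integers absorbs the endowment of `i`.
  have h4 : (wealth v x i : ℝ) ≤ value v i S := by exact_mod_cast hlt
  have h5 : (wealth v x i : ℝ) ≤ U := by exact_mod_cast wealth_le v x i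
  have hU1 : (1 : ℝ) ≤ U := by rw [hU]; push_cast; have : (0 : ℝ) ≤ m * vmax v := by positivity
                               linarith
  have hK4 : (K : ℝ) = 4 * U ^ 2 := by rw [hKdef]; push_cast; ring
  have hK1 : (1 : ℝ) ≤ K := by exact_mod_cast hK
  have h6 : θ * θ ^ f k ≤ (θ ^ 2 - 1) * (θ ^ f i * U) := by
    have h7 : θ ^ f i * wealth v x i ≤ θ ^ f i * value v i S := by gcongr
    have h8 : θ * θ ^ f k ≤ (θ ^ 2 - 1) * (θ ^ f i * wealth v x i) := by
      have := mul_le_mul_of_nonneg_left h2 (by positivity : (0 : ℝ) ≤ θ)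
      nlinarith
    refine h8.trans ?_
    have : (0 : ℝ) ≤ θ ^ 2 - 1 := by nlinarith
    gcongr
  have h7 : (θ ^ 2 - 1) * K ≤ 3 := by
    have e : (θ ^ 2 - 1) * K = 2 + 1 / K := by rw [hθdef]; field_simp; ring
    have : (1 : ℝ) / K ≤ 1 := by rw [div_le_one hK']; exact hK1
    rw [e]; linarith
  have h8 : (θ ^ 2 - 1) * (θ ^ f i * U) * 4 ≤ 3 * θ ^ f k := by
    have h0 : (0 : ℝ) ≤ θ ^ 2 - 1 := by nlinarith
    calc (θ ^ 2 - 1) * (θ ^ f i * U) * 4 ≤ (θ ^ 2 - 1) * ((θ ^ f k * U) * U) * 4 := by gcongr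
      _ = ((θ ^ 2 - 1) * K) * θ ^ f k := by rw [hK4]; ring
      _ ≤ 3 * θ ^ f k := by gcongr
  nlinarith

end Final

end Market

/-! ### Reachability along tight goods -/

section Reach

open Classical in
/-- The agents that can be reached from the poorest agents along at most `t` tight goods. -/
noncomputable def reach {n m : ℕ} (v : Fin n → Fin m → ℕ) (lam : ℕ → ℕ) (x : Allocation n m)
    (f : Fin n → ℕ) (σ : ℕ) : ℕ → Finset (Fin n)
  | 0 => Finset.univ.filter fun i => f i + lam (wealth v x i) ≤ σ
  | t + 1 => reach v lam x f σ t ∪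
      Finset.univ.filter fun k => ∃ a ∈ reach v lam x f σ t, ∃ j, x j = k ∧ Tight v lam x f a j

/-- The distance of agent `k` from the poorest agents, or `n` if it cannot be reached. -/
noncomputable def level {n m : ℕ} (v : Fin n → Fin m → ℕ) (lam : ℕ → ℕ) (x : Allocation n m)
    (f : Fin n → ℕ) (σ : ℕ) (k : Fin n) : ℕ :=
  ((Finset.range n).filter fun t => k ∉ reach v lam x f σ t).card

/-- Good `j` can be given to agent `a`, who is nearer to the poorest agents than its owner, and
the owner remains richer than the poorest agents. -/
def Movable {n m : ℕ} (v : Fin n → Fin m → ℕ) (lam : ℕ → ℕ) (x : Allocation n m) (f : Fin n → ℕ)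
    (σ : ℕ) (a : Fin n) (j : Fin m) : Prop :=
  Tight v lam x f a j ∧ level v lam x f σ a < level v lam x f σ (x j) ∧
    σ < f (x j) + lam (wealth v x (x j) - v (x j) j)

variable {n m : ℕ} {v : Fin n → Fin m → ℕ} {lam : ℕ → ℕ} {x : Allocation n m} {f : Fin n → ℕ}
  {σ : ℕ}

lemma mem_reach_zero {i : Fin n} :
    i ∈ reach v lam x f σ 0 ↔ f i + lam (wealth v x i) ≤ σ := by
  simp [reach]

lemma mem_reach_succ {t : ℕ} {k : Fin n} :
    k ∈ reach v lam x f σ (t + 1) ↔ k ∈ reach v lam x f σ t ∨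
      ∃ a ∈ reach v lam x f σ t, ∃ j, x j = k ∧ Tight v lam x f a j := by
  simp [reach]

lemma reach_mono : Monotone (reach v lam x f σ) :=
  monotone_nat_of_le_succ fun _ _ hk => mem_reach_succ.2 (Or.inl hk)

lemma level_le_card {k : Fin n} : level v lam x f σ k ≤ n :=
  (Finset.card_filter_le _ _).trans (by simp)

/-- Since `reach` increases, the steps that miss `k` form an initial segment, whose length is the
first step that contains `k`. -/
lemma level_le_iff {k : Fin n} {t : ℕ} (ht : t < n) :
    level v lam x f σ k ≤ t ↔ k ∈ reach v lam x f σ t := by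
  constructor
  · intro h
    by_contra hk
    have : Finset.range (t + 1) ⊆ (Finset.range n).filter fun t => k ∉ reach v lam x f σ t := by
      intro t' ht'
      rw [Finset.mem_range] at ht'
      refine Finset.mem_filter.2 ⟨Finset.mem_range.2 (by omega), fun h' => hk ?_⟩
      exact reach_mono (by omega : t' ≤ t) h'
    have := Finset.card_le_card this
    rw [Finset.card_range] at this
    unfold level at h
    omega
  · intro h
    have : ((Finset.range n).filter fun t => k ∉ reach v lam x f σ t) ⊆ Finset.range t := by
      intro t' ht'
      rw [Finset.mem_filter] at ht'
      rw [Finset.mem_range]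
      by_contra h'
      exact ht'.2 (reach_mono (by omega : t ≤ t') h)
    simpa [level] using Finset.card_le_card this

lemma level_lt_iff {k : Fin n} : level v lam x f σ k < n ↔ k ∈ reach v lam x f σ (n - 1) := by
  have := k.pos
  rw [← level_le_iff (by omega)]
  omega

lemma level_eq_succ {k : Fin n} {t : ℕ} (ht : t < n) (h1 : k ∈ reach v lam x f σ (t + 1))
    (h2 : k ∉ reach v lam x f σ t) : level v lam x f σ k = t + 1 := by
  rw [← level_le_iff ht] at h2
  rcases Nat.lt_or_ge (t + 1) n with h | h
  · rw [← level_le_iff h] at h1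
    omega
  · have := level_le_card (v := v) (lam := lam) (x := x) (f := f) (σ := σ) (k := k)
    omega

lemma level_eq_zero {k : Fin n} : level v lam x f σ k = 0 ↔ f k + lam (wealth v x k) ≤ σ := by
  rw [← mem_reach_zero, ← level_le_iff k.pos, Nat.le_zero]

/-- A round that adds nobody is followed only by such rounds; until then every round adds an agent.
-/
lemma reach_stable_or (t : ℕ) :
    reach v lam x f σ (t + 1) = reach v lam x f σ t ∨ t + 1 ≤ (reach v lam x f σ t).card := by
  induction t with
  | zero =>
    rcases Finset.eq_empty_or_nonempty (reach v lam x f σ 0) with h | h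
    · left
      ext k
      rw [mem_reach_succ, h]
      simp
    · exact Or.inr h.card_pos
  | succ t ih =>
    rcases ih with ih | ih
    · left
      ext k
      rw [mem_reach_succ, ih, ← mem_reach_succ, ih]
    · by_cases h : reach v lam x f σ (t + 1) = reach v lam x f σ t
      · left
        ext k
        rw [mem_reach_succ, h, ← mem_reach_succ, h]
      · right
        have : reach v lam x f σ t ⊂ reach v lam x f σ (t + 1) :=
          (reach_mono (Nat.le_succ t)).ssubset_of_ne (Ne.symm h)
        have := Finset.card_lt_card this
        omega

/-- After `n - 1` rounds the search is stable or contains everybody, so the reached agents are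
closed under tight goods. -/
lemma level_lt_of_tight {a : Fin n} {j : Fin m} (ha : level v lam x f σ a < n)
    (h : Tight v lam x f a j) : level v lam x f σ (x j) < n := by
  have hn := a.pos
  rw [level_lt_iff] at ha ⊢
  have h1 : x j ∈ reach v lam x f σ (n - 1 + 1) := mem_reach_succ.2 (Or.inr ⟨a, ha, j, rfl, h⟩)
  rcases reach_stable_or (v := v) (lam := lam) (x := x) (f := f) (σ := σ) (n - 1) with h2 | h2
  · rwa [h2] at h1
  · have : reach v lam x f σ (n - 1) = Finset.univ := by
      rw [← Finset.card_eq_iff_eq_univ, Fintype.card_fin]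
      have := Finset.card_le_univ (reach v lam x f σ (n - 1))
      rw [Fintype.card_fin] at this
      omega
    rw [this]
    exact Finset.mem_univ _

lemma level_le_succ_of_tight {a : Fin n} {j : Fin m} (h : Tight v lam x f a j) :
    level v lam x f σ (x j) ≤ level v lam x f σ a + 1 := by
  have h0 := level_le_card (v := v) (lam := lam) (x := x) (f := f) (σ := σ) (k := x j)
  rcases Nat.lt_or_ge (level v lam x f σ a + 1) n with h1 | h1
  · rw [level_le_iff h1]
    exact mem_reach_succ.2 (Or.inr ⟨a, (level_le_iff (by omega)).1 le_rfl, j, rfl, h⟩)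
  · omega

/-! ### The three outcomes of an iteration -/

/-- At level `0` the spending is at most `σ`, so any good serves. At level `t + 1` the last good on
a shortest path serves: it would be movable if its removal left the owner above `σ`. -/
theorem fair_of_stuck {K : ℕ} (hK : 0 < K) (hlam : IsLogTable K (m * vmax v + 1) lam)
    (hmov : ∀ a j, ¬ Movable v lam x f σ a j) (hall : ∀ k, level v lam x f σ k < n) (k : Fin n)
    (hne : (bundle x k).Nonempty) :
    ∃ j ∈ bundle x k, f k + lam (wealth v x k - v k j) ≤ σ := by
  rcases h : level v lam x f σ k with _ | t
  · obtain ⟨j, hj⟩ := hne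
    refine ⟨j, hj, ?_⟩
    rw [level_eq_zero] at h
    obtain rfl : x j = k := (Finset.mem_filter.1 hj).2
    have h1 : 0 < wealth v x (x j) - v (x j) j := by rw [wealth_sub]; exact Nat.succ_pos _
    have := hlam.mono hK h1 (Nat.sub_le _ _) (wealth_le v x (x j))
    omega
  · have ht : t + 1 < n := h ▸ hall k
    have h1 : k ∈ reach v lam x f σ (t + 1) := (level_le_iff ht).1 h.le
    have h2 : k ∉ reach v lam x f σ t := fun h' => by
      have := (level_le_iff (by omega)).2 h'
      omega
    obtain ⟨a, ha, j, rfl, hj⟩ := (mem_reach_succ.1 h1).resolve_left h2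
    refine ⟨j, by simp [bundle], ?_⟩
    by_contra hlt
    refine hmov a j ⟨hj, ?_, by omega⟩
    have := (level_le_iff (by omega)).2 ha
    omega

/-- The logarithms of the weights after those of the agents within reach have been raised. -/
noncomputable def raise (v : Fin n → Fin m → ℕ) (lam : ℕ → ℕ) (x : Allocation n m)
    (f : Fin n → ℕ) (σ : ℕ) (i : Fin n) : ℕ :=
  if level v lam x f σ i < n then f i + 1 else f i

/-- A reached agent keeps `σ - f i`, an unreached one gains one; `weight_le` makes the truncated
subtraction exact. -/
lemma Valid.sum_lt_raise (hx : Valid v lam x f σ) {k : Fin n} (hk : ¬ level v lam x f σ k < n) :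
    ∑ i, (σ - f i) < ∑ i, (σ + 1 - raise v lam x f σ i) := by
  refine Finset.sum_lt_sum (fun i _ => ?_) ⟨k, Finset.mem_univ k, ?_⟩
  · have := hx.weight_le i
    unfold raise
    split_ifs <;> omega
  · have := hx.weight_le k
    rw [raise, if_neg hk]
    omega

/-- Where a reached agent ties with an owner, the owner is reached and rises too; elsewhere the
integer gap between the offers leaves room for one step. An unreached agent is not among the
poorest, so its spending is already at least `σ + 1`. -/
theorem Valid.raise (hx : Valid v lam x f σ) {k : Fin n} (hk : ¬ level v lam x f σ k < n) :
    Valid v lam x (raise v lam x f σ) (σ + 1) where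
  feasible a j h := by
    refine ⟨(hx.feasible a j h).1, ?_⟩
    have h1 := (hx.feasible a j h).2
    by_cases ht : Tight v lam x f a j
    · have := level_lt_of_tight (σ := σ) (a := a) (j := j) (h := ht)
      unfold bid FairDivision.raise at *
      split_ifs <;> omega
    · have h2 : bid v lam f a j < bid v lam f (x j) j := by
        by_contra h3
        exact ht ⟨h, by omega⟩
      unfold bid FairDivision.raise at *
      split_ifs <;> omega
  le_spending i := by
    have h1 := hx.le_spending i
    unfold FairDivision.raise
    split_ifs with h
    · omega
    · have : ¬ level v lam x f σ i = 0 := fun h0 => h (h0 ▸ i.pos)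
      rw [level_eq_zero] at this
      omega
  weight_le i := by
    have := hx.weight_le i
    unfold FairDivision.raise
    split_ifs <;> omega
  le_sum := by
    have := hx.sum_lt_raise hk
    have := hx.le_sum
    omega

lemma bundle_update_of_ne {a i : Fin n} {j : Fin m} (hi : i ≠ a) (hij : i ≠ x j) :
    bundle (Function.update x j a) i = bundle x i := by
  ext j'
  simp only [bundle, Finset.mem_filter, Finset.mem_univ, true_and, Function.update_apply]
  split_ifs with h
  · subst h
    exact ⟨fun h => absurd h.symm hi, fun h => absurd h.symm hij⟩
  · rfl

lemma wealth_update_owner {a : Fin n} {j : Fin m} (ha : a ≠ x j) :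
    wealth v (Function.update x j a) (x j) = wealth v x (x j) - v (x j) j := by
  rw [wealth_sub, wealth]
  congr 2
  ext j'
  simp only [bundle, Finset.mem_filter, Finset.mem_univ, true_and, Function.update_apply,
    Finset.mem_erase]
  split_ifs with h
  · subst h
    simp [ha]
  · simp [h]

lemma wealth_le_update {a : Fin n} {j : Fin m} :
    wealth v x a ≤ wealth v (Function.update x j a) a := by
  refine Nat.succ_le_succ (Finset.sum_le_sum_of_subset fun j' hj' => ?_)
  simp only [bundle, Finset.mem_filter, Finset.mem_univ, true_and, Function.update_apply] at hj' ⊢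
  split_ifs <;> simp [hj']

lemma Movable.ne {a : Fin n} {j : Fin m} (h : Movable v lam x f σ a j) : a ≠ x j := by
  rintro rfl
  exact lt_irrefl _ h.2.1

lemma Movable.bid_eq (hx : Feasible v lam x f) {a : Fin n} {j : Fin m}
    (h : Movable v lam x f σ a j) : bid v lam f a j = bid v lam f (x j) j :=
  le_antisymm (hx a j h.1.1).2 h.1.2

lemma Movable.price_eq (hx : Feasible v lam x f) {a : Fin n} {j : Fin m}
    (h : Movable v lam x f σ a j) (j' : Fin m) :
    bid v lam f (Function.update x j a j') j' = bid v lam f (x j') j' := by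
  rw [Function.update_apply]
  split_ifs with h'
  · subst h'
    exact h.bid_eq hx
  · rfl

/-- The new owner ties with the old one, so no price changes, and the old owner stays above `σ` by
the last clause of `Movable`. -/
theorem Valid.move {K : ℕ} (hK : 0 < K) (hlam : IsLogTable K (m * vmax v + 1) lam)
    (hx : Valid v lam x f σ) {a : Fin n} {j : Fin m} (h : Movable v lam x f σ a j) :
    Valid v lam (Function.update x j a) f σ where
  feasible a' j' h' := by
    rw [h.price_eq hx.feasible]
    refine ⟨?_, (hx.feasible a' j' h').2⟩
    rw [Function.update_apply]
    split_ifs with h''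
    · subst h''
      exact h.1.1
    · exact (hx.feasible a' j' h').1
  le_spending i := by
    by_cases hi : i = x j
    · subst hi
      rw [wealth_update_owner h.ne]
      exact h.2.2.le
    · have h1 := hx.le_spending i
      by_cases hia : i = a
      · subst hia
        have := hlam.mono hK (Nat.succ_pos _) (wealth_le_update (v := v) (x := x) (j := j))
          (wealth_le v _ i)
        exact h1.trans (Nat.add_le_add_left this _)
      · rwa [wealth, bundle_update_of_ne hia hi]
  weight_le := hx.weight_le
  le_sum := hx.le_sum

/-- Nobody joins the poorest, since the old owner stays above `σ`. New edges lead only to `a`,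
through `j`; whoever is tight for `j` has level at least `level (x j) - 1`, hence at least that of
`a`, so these edges are no shortcuts. -/
lemma Valid.reach_move_subset {K : ℕ} (hK : 0 < K) (hlam : IsLogTable K (m * vmax v + 1) lam)
    (hx : Valid v lam x f σ) {a : Fin n} {j : Fin m} (h : Movable v lam x f σ a j) (t : ℕ)
    (ht : t < n) : reach v lam (Function.update x j a) f σ t ⊆ reach v lam x f σ t := by
  induction t with
  | zero =>
    intro i hi
    rw [mem_reach_zero] at hi ⊢
    by_cases hij : i = x j
    · subst hij
      rw [wealth_update_owner h.ne] at hi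
      exact absurd hi (not_le.2 h.2.2)
    · by_cases hia : i = a
      · subst hia
        have := hlam.mono hK (Nat.succ_pos _) (wealth_le_update (v := v) (x := x) (j := j))
          (wealth_le v _ i)
        exact (Nat.add_le_add_left this _).trans hi
      · rwa [wealth, bundle_update_of_ne hia hij] at hi
  | succ t ih =>
    intro k hk
    have ih := ih (by omega)
    rcases mem_reach_succ.1 hk with hk | ⟨b, hb, j', hj', htight⟩
    · exact reach_mono (Nat.le_succ t) (ih hk)
    · have htight' : Tight v lam x f b j' := ⟨htight.1, h.price_eq hx.feasible j' ▸ htight.2⟩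
      by_cases hjj : j' = j
      · subst hjj
        rw [Function.update_self] at hj'
        subst hj'
        have h1 := level_le_succ_of_tight (σ := σ) htight'
        have h2 := (level_le_iff (by omega)).2 (ih hb)
        have h3 := h.2.1
        rw [← level_le_iff ht]
        omega
      · rw [Function.update_of_ne hjj] at hj'
        exact mem_reach_succ.2 (Or.inr ⟨b, ih hb, j', hj', htight'⟩)

lemma Valid.level_le_move {K : ℕ} (hK : 0 < K) (hlam : IsLogTable K (m * vmax v + 1) lam)
    (hx : Valid v lam x f σ) {a : Fin n} {j : Fin m} (h : Movable v lam x f σ a j) (k : Fin n) :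
    level v lam x f σ k ≤ level v lam (Function.update x j a) f σ k := by
  refine Finset.card_le_card fun t ht => ?_
  rw [Finset.mem_filter] at ht ⊢
  exact ⟨ht.1, fun h' => ht.2 (hx.reach_move_subset hK hlam h t (Finset.mem_range.1 ht.1) h')⟩

/-! ### Termination -/

/-- Decreases whenever a good is moved. -/
noncomputable def potential (v : Fin n → Fin m → ℕ) (lam : ℕ → ℕ) (x : Allocation n m)
    (f : Fin n → ℕ) (σ : ℕ) : ℕ :=
  (m * n + 1) * ∑ k, (n - level v lam x f σ k) + ∑ j, level v lam x f σ (x j)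

lemma sum_level_le : ∑ j, level v lam x f σ (x j) ≤ m * n := by
  simpa using Finset.sum_le_card_nsmul Finset.univ (fun j => level v lam x f σ (x j)) n
    fun j _ => level_le_card

lemma potential_lt : potential v lam x f σ < (m * n + 1) * (n * n + 1) := by
  have h1 : ∑ k, (n - level v lam x f σ k) ≤ n * n := by
    simpa using Finset.sum_le_card_nsmul Finset.univ (fun k => n - level v lam x f σ k) n
      fun k _ => Nat.sub_le _ _
  have h2 := sum_level_le (v := v) (lam := lam) (x := x) (f := f) (σ := σ)
  unfold potential
  nlinarith [Nat.mul_le_mul_left (m * n + 1) h1]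

/-- Levels never fall. If one rises, the first term loses at least `m * n + 1`, more than the second
can gain; if none changes, the moved good reaches an owner of smaller level. -/
theorem Valid.potential_move_lt {K : ℕ} (hK : 0 < K) (hlam : IsLogTable K (m * vmax v + 1) lam)
    (hx : Valid v lam x f σ) {a : Fin n} {j : Fin m} (h : Movable v lam x f σ a j) :
    potential v lam (Function.update x j a) f σ < potential v lam x f σ := by
  have hle := hx.level_le_move hK hlam h
  by_cases heq : ∀ k, level v lam (Function.update x j a) f σ k = level v lam x f σ k
  · unfold potential
    simp only [heq]
    refine Nat.add_lt_add_left (Finset.sum_lt_sum (fun j' _ => ?_) ⟨j, Finset.mem_univ j, ?_⟩) _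
    · rw [Function.update_apply]
      split_ifs with h'
      · subst h'
        exact h.2.1.le
      · rfl
    · rw [Function.update_self]
      exact h.2.1
  · push Not at heq
    obtain ⟨k, hk⟩ := heq
    have h1 : ∑ i, (n - level v lam (Function.update x j a) f σ i) <
        ∑ i, (n - level v lam x f σ i) := by
      refine Finset.sum_lt_sum (fun i _ => Nat.sub_le_sub_left (hle i) n)
        ⟨k, Finset.mem_univ k, ?_⟩
      have := hle k
      have := level_le_card (v := v) (lam := lam) (x := Function.update x j a) (f := f) (σ := σ)
        (k := k)
      omega
    have h2 := sum_level_le (v := v) (lam := lam) (x := Function.update x j a) (f := f) (σ := σ)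
    have h3 := Nat.mul_le_mul_left (m * n + 1) (Nat.succ_le_of_lt h1)
    rw [Nat.mul_succ] at h3
    unfold potential
    omega

/-- By `le_spending`, `σ - f i` is at most the logarithm of a wealth. -/
lemma Valid.sum_le {K : ℕ} (hK : 0 < K) (hlam : IsLogTable K (m * vmax v + 1) lam)
    (hx : Valid v lam x f σ) : ∑ i, (σ - f i) ≤ n * (K * (m * vmax v + 1)) := by
  have : ∀ i ∈ (Finset.univ : Finset (Fin n)), σ - f i ≤ K * (m * vmax v + 1) := by
    intro i _
    have h1 := hx.le_spending i
    have h2 := hlam.le_mul hK (Nat.succ_pos _) (wealth_le v x i)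
    have h3 : lam (wealth v x i) ≤ K * (m * vmax v + 1) := h2
    omega
  simpa using Finset.sum_le_card_nsmul _ _ _ this

/-- Decreases in every iteration of the algorithm. -/
noncomputable def measure (v : Fin n → Fin m → ℕ) (lam : ℕ → ℕ) (N : ℕ) (x : Allocation n m)
    (f : Fin n → ℕ) (σ : ℕ) : ℕ :=
  (N - ∑ i, (σ - f i)) * ((m * n + 1) * (n * n + 1)) + potential v lam x f σ

theorem Valid.measure_move_lt {K : ℕ} (hK : 0 < K) (hlam : IsLogTable K (m * vmax v + 1) lam)
    (hx : Valid v lam x f σ) {a : Fin n} {j : Fin m} (h : Movable v lam x f σ a j) (N : ℕ) :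
    measure v lam N (Function.update x j a) f σ < measure v lam N x f σ :=
  Nat.add_lt_add_left (hx.potential_move_lt hK hlam h) _

theorem Valid.measure_raise_lt {K : ℕ} (hK : 0 < K) (hlam : IsLogTable K (m * vmax v + 1) lam)
    (hx : Valid v lam x f σ) {k : Fin n} (hk : ¬ level v lam x f σ k < n) :
    measure v lam (n * (K * (m * vmax v + 1))) x (FairDivision.raise v lam x f σ) (σ + 1) <
      measure v lam (n * (K * (m * vmax v + 1))) x f σ := by
  have h1 := hx.sum_lt_raise hk
  have h2 := (hx.raise hk).sum_le hK hlam
  have h3 := potential_lt (v := v) (lam := lam) (x := x) (f := FairDivision.raise v lam x f σ)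
    (σ := σ + 1)
  unfold measure
  set N := n * (K * (m * vmax v + 1))
  set B := (m * n + 1) * (n * n + 1)
  set G := ∑ i, (σ - f i)
  set G' := ∑ i, (σ + 1 - FairDivision.raise v lam x f σ i)
  -- The raised state is valid too, so `G' ≤ N` and nothing is truncated. The drop by one outweighs
  -- any growth of the potential, which is always below `B`.
  have h4 : N - G' + 1 ≤ N - G := by omega
  nlinarith [Nat.mul_le_mul_right B h4]

lemma measure_lt (N : ℕ) : measure v lam N x f σ < (N + 1) * ((m * n + 1) * (n * n + 1)) := by
  have h3 := potential_lt (v := v) (lam := lam) (x := x) (f := f) (σ := σ)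
  unfold measure
  have := Nat.mul_le_mul_right ((m * n + 1) * (n * n + 1)) (Nat.sub_le N (∑ i, (σ - f i)))
  nlinarith

/-- The state in which every good belongs to an agent who values it most. -/
theorem valid_of_maximal {K : ℕ} (hK : 0 < K) (hlam : IsLogTable K (m * vmax v + 1) lam)
    (hx : ∀ i j, v i j ≤ v (x j) j) : Valid v lam x (fun _ => 0) 0 where
  feasible a j h := ⟨h.trans_le (hx a j), Nat.add_le_add_left
    (hlam.mono hK h (hx a j) (entry_le v _ j)) _⟩
  le_spending _ := Nat.zero_le _
  weight_le _ := le_rfl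
  le_sum := Nat.zero_le _

end Reach

/-! ### Running time of programs on bounded memories -/

section Machine

/-- All cells hold numbers with at most `L` binary digits. -/
def Bounded (L : ℕ) (s : Memory) : Prop :=
  ∀ a k, s a k < 2 ^ L

/-- On a memory with cells of at most `L` digits, both the cost of an expression and the length of
its value are at most `L + 1` times this constant. -/
def Expr.weight : Expr → ℕ
  | .lit c => 1 + c.size
  | .read _ e => e.weight + 1
  | .add e f => 2 * (e.weight + f.weight) + 1
  | .sub e f => 2 * (e.weight + f.weight) + 1
  | .mul e f => 2 * (e.weight + f.weight) + 1
  | .div e f => 2 * (e.weight + f.weight) + 1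

lemma size_add_le (a b : ℕ) : (a + b).size ≤ a.size + b.size + 1 := by
  rw [Nat.size_le]
  have h1 := Nat.lt_size_self a
  have h2 := Nat.lt_size_self b
  have h3 := Nat.pow_le_pow_right (n := 2) (by norm_num) (Nat.le_add_right a.size b.size)
  have h4 := Nat.pow_le_pow_right (n := 2) (by norm_num) (Nat.le_add_left b.size a.size)
  rw [pow_succ]
  omega

lemma size_mul_le (a b : ℕ) : (a * b).size ≤ a.size + b.size := by
  rw [Nat.size_le, pow_add]
  exact Nat.mul_lt_mul'' (Nat.lt_size_self a) (Nat.lt_size_self b)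

/-- Length and cost are bounded together because each operation also pays for the length of its
result. The `+ 1` next to the length covers carries and the unit charge. -/
lemma Expr.size_and_cost_le {L : ℕ} {s : Memory} (hs : Bounded L s) (e : Expr) :
    (e.eval s).size + 1 ≤ e.weight * (L + 1) ∧ e.cost s ≤ e.weight * (L + 1) := by
  have key : ∀ e f r : ℕ, ∀ {a b c d : ℕ}, (a + 1 ≤ e * (L + 1) ∧ c ≤ e * (L + 1)) →
      (b + 1 ≤ f * (L + 1) ∧ d ≤ f * (L + 1)) → r ≤ a + b + 1 →
      r + 1 ≤ (2 * (e + f) + 1) * (L + 1) ∧ c + d + (1 + r) ≤ (2 * (e + f) + 1) * (L + 1) := by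
    intro e f r a b c d h1 h2 h3
    have : (2 * (e + f) + 1) * (L + 1) = 2 * (e * (L + 1)) + 2 * (f * (L + 1)) + (L + 1) := by
      ring
    omega
  induction e with
  | lit c =>
    simp only [Expr.eval, Expr.cost, Expr.weight]
    constructor <;> nlinarith
  | read a e ih =>
    have h1 : (s a (e.eval s)).size ≤ L := Nat.size_le.2 (hs _ _)
    have h2 : (e.weight + 1) * (L + 1) = e.weight * (L + 1) + (L + 1) := by ring
    simp only [Expr.eval, Expr.cost, Expr.weight]
    omega
  | add e f ihe ihf => exact key _ _ _ ihe ihf (size_add_le _ _)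
  | sub e f ihe ihf =>
    exact key _ _ _ ihe ihf ((Nat.size_le_size (Nat.sub_le _ _)).trans (by omega))
  | mul e f ihe ihf => exact key _ _ _ ihe ihf ((size_mul_le _ _).trans (by omega))
  | div e f ihe ihf =>
    exact key _ _ _ ihe ihf ((Nat.size_le_size (Nat.div_le_self _ _)).trans (by omega))

lemma Memory.write_apply (s : Memory) (a k w b l : ℕ) :
    s.write a k w b l = if b = a ∧ l = k then w else s b l := by
  unfold Memory.write
  by_cases h : b = a
  · subst h
    by_cases h' : l = k <;> simp [h']
  · simp [h]

lemma Memory.write_of_ne (s : Memory) {a b : ℕ} (h : b ≠ a) (k w : ℕ) : s.write a k w b = s b := by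
  simp [Memory.write, h]

lemma Bounded.write {L : ℕ} {s : Memory} (hs : Bounded L s) {w : ℕ} (hw : w < 2 ^ L) (a k : ℕ) :
    Bounded L (s.write a k w) := by
  intro b l
  rw [Memory.write_apply]
  split_ifs
  · exact hw
  · exact hs b l

/-- The effect of a program without loops. -/
def Program.exec : Program → Memory → Memory
  | .skip, s => s
  | .assign a pos val, s => s.write a (pos.eval s) (val.eval s)
  | .seq P Q, s => Q.exec (P.exec s)
  | .branch cond P Q, s => if cond.eval s = 0 then Q.exec s else P.exec s
  | .loop _ _, s => s

/-- The program has no loops and writes only numbers with at most `L` digits. -/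
def Program.Safe (L : ℕ) : Program → Memory → Prop
  | .skip, _ => True
  | .assign _ _ val, s => val.eval s < 2 ^ L
  | .seq P Q, s => P.Safe L s ∧ Q.Safe L (P.exec s)
  | .branch cond P Q, s => (cond.eval s ≠ 0 → P.Safe L s) ∧ (cond.eval s = 0 → Q.Safe L s)
  | .loop _ _, _ => False

/-- The running time of a program without loops, in units of `L + 1`. -/
def Program.weight : Program → ℕ
  | .skip => 1
  | .assign _ pos val => 1 + pos.weight + val.weight
  | .seq P Q => P.weight + Q.weight
  | .branch cond P Q => 1 + cond.weight + P.weight + Q.weight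
  | .loop _ _ => 0

/-- Started on `s`, the program `P` halts in time at most `T * (L + 1)` on a bounded memory that
satisfies `Q`. -/
def Achieves (L : ℕ) (P : Program) (T : ℕ) (s : Memory) (Q : Memory → Prop) : Prop :=
  ∃ t s', Runs P s t s' ∧ t ≤ T * (L + 1) ∧ Bounded L s' ∧ Q s'

variable {L : ℕ}

lemma Achieves.mono {P : Program} {T T' : ℕ} {s : Memory} {Q Q' : Memory → Prop}
    (h : Achieves L P T s Q) (hT : T ≤ T') (hQ : ∀ s', Bounded L s' → Q s' → Q' s') :
    Achieves L P T' s Q' := by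
  obtain ⟨t, s', h1, h2, h3, h4⟩ := h
  exact ⟨t, s', h1, h2.trans (Nat.mul_le_mul_right _ hT), h3, hQ s' h3 h4⟩

lemma Achieves.seq {P P' : Program} {T T' : ℕ} {s : Memory} {Q Q' : Memory → Prop}
    (h : Achieves L P T s Q) (h' : ∀ s', Bounded L s' → Q s' → Achieves L P' T' s' Q') :
    Achieves L (.seq P P') (T + T') s Q' := by
  obtain ⟨t, s', h1, h2, h3, h4⟩ := h
  obtain ⟨u, s'', h5, h6, h7, h8⟩ := h' s' h3 h4
  refine ⟨t + u, s'', .seq h1 h5, ?_, h7, h8⟩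
  rw [add_mul]
  exact Nat.add_le_add h2 h6

lemma Achieves.branch {cond : Expr} {P P' : Program} {T T' : ℕ} {s : Memory}
    {Q : Memory → Prop} (hs : Bounded L s) (h : cond.eval s ≠ 0 → Achieves L P T s Q)
    (h' : cond.eval s = 0 → Achieves L P' T' s Q) :
    Achieves L (.branch cond P P') (1 + cond.weight + T + T') s Q := by
  have hc := (cond.size_and_cost_le hs).2
  have e : (1 + cond.weight + T + T') * (L + 1) =
      (L + 1) + cond.weight * (L + 1) + T * (L + 1) + T' * (L + 1) := by ring
  by_cases h0 : cond.eval s = 0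
  · obtain ⟨t, s', h1, h2, h3, h4⟩ := h' h0
    exact ⟨_, s', .branch_false h0 h1, by omega, h3, h4⟩
  · obtain ⟨t, s', h1, h2, h3, h4⟩ := h h0
    exact ⟨_, s', .branch_true h0 h1, by omega, h3, h4⟩

/-- Reduces code without loops to computing `exec`; its time is read off the syntax. -/
lemma Achieves.of_safe {P : Program} {s : Memory} (hs : Bounded L s) (h : P.Safe L s)
    {Q : Memory → Prop} (hQ : Q (P.exec s)) : Achieves L P P.weight s Q := by
  induction P generalizing s Q with
  | skip => exact ⟨1, s, .skip s, by simp [Program.weight], hs, hQ⟩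
  | assign a pos val =>
    refine ⟨_, _, .assign a pos val s, ?_, hs.write h a _, hQ⟩
    have h1 := (pos.size_and_cost_le hs).2
    have h2 := (val.size_and_cost_le hs).2
    have e : (1 + pos.weight + val.weight) * (L + 1) =
      (L + 1) + pos.weight * (L + 1) + val.weight * (L + 1) := by ring
    rw [Program.weight]
    omega
  | seq P P' ih ih' =>
    refine (ih hs h.1 (Q := (· = P.exec s)) rfl).seq fun s' hs' e => ?_
    subst e
    exact ih' hs' h.2 hQ
  | branch cond P P' ih ih' =>
    refine Achieves.branch hs (fun h0 => ih hs (h.1 h0) ?_) fun h0 => ih' hs (h.2 h0) ?_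
    · simpa [Program.exec, h0] using hQ
    · simpa [Program.exec, h0] using hQ
  | loop cond P _ => exact h.elim

/-- The index of `Inv` is a rank that every pass lowers, so there are at most `N` passes; one more
unit pays for the last test. -/
lemma Achieves.loop {cond : Expr} {P : Program} {T : ℕ} (Inv : ℕ → Memory → Prop)
    (hstep : ∀ k s, Bounded L s → Inv k s → cond.eval s ≠ 0 →
      Achieves L P T s fun s' => ∃ k' < k, Inv k' s')
    {N : ℕ} {s : Memory} (hs : Bounded L s) (h : Inv N s) :
    Achieves L (.loop cond P) ((N + 1) * (T + (1 + cond.weight))) s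
      fun s' => cond.eval s' = 0 ∧ ∃ k, Inv k s' := by
  induction N using Nat.strong_induction_on generalizing s with
  | _ N ih =>
    have hc := (cond.size_and_cost_le hs).2
    have e : (N + 1) * (T + (1 + cond.weight)) * (L + 1) = N * (T + (1 + cond.weight)) * (L + 1) +
      (T * (L + 1) + (L + 1) + cond.weight * (L + 1)) := by ring
    by_cases h0 : cond.eval s = 0
    · have hrun : Runs (.loop cond P) s (1 + cond.cost s) s := by
        constructor
        exact h0
      exact ⟨_, s, hrun, by omega, hs, h0, N, h⟩
    · obtain ⟨t, s', h1, h2, h3, k, hk, h4⟩ := hstep N s hs h h0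
      obtain ⟨u, s'', h5, h6, h7, h8⟩ := ih k hk h3 h4
      refine ⟨_, s'', .loop_step h0 h1 h5, ?_, h7, h8⟩
      have : (k + 1) * (T + (1 + cond.weight)) * (L + 1) ≤
        N * (T + (1 + cond.weight)) * (L + 1) := by gcongr; omega
      omega

/-- The scalar variable that is kept in array `a`. -/
abbrev scalar (a : ℕ) : Expr := .read a (.lit 0)

/-- `for c := 0, …, bound - 1 do P`. -/
def forLoop (c : ℕ) (bound : Expr) (P : Program) : Program :=
  .seq (.assign c (.lit 0) (.lit 0)) (.loop (.sub bound (scalar c))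
    (.seq P (.assign c (.lit 0) (.add (scalar c) (.lit 1)))))

/-- The time of `N` passes through a loop that takes time `T` per pass and has overhead `w`. -/
def loopTime {R : Type*} [CommSemiring R] (w : ℕ) (N T : R) : R :=
  (N + 1) * (T + w)

/-- The overhead of `forLoop c bound _`. -/
def forWeight (c : ℕ) (bound : Expr) : ℕ :=
  (Program.assign c (.lit 0) (.lit 0)).weight +
    (Program.assign c (.lit 0) (.add (scalar c) (.lit 1))).weight +
    (1 + (Expr.sub bound (scalar c)).weight)

/-- The loop overwrites its own counter, so `Inv` has to be insensitive to that cell; the counter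
ends at `N`, which therefore has to fit into a cell. -/
lemma Achieves.forLoop {c : ℕ} {bound : Expr} {P : Program} {T N : ℕ} (Inv : ℕ → Memory → Prop)
    (hN : N < 2 ^ L) (hbound : ∀ i s, Inv i s → bound.eval s = N)
    (hcounter : ∀ i s w, Inv i s → Inv i (s.write c 0 w))
    (hstep : ∀ i < N, ∀ s, Bounded L s → s c 0 = i → Inv i s →
      Achieves L P T s fun s' => s' c 0 = i ∧ Inv (i + 1) s')
    {s : Memory} (hs : Bounded L s) (h : Inv 0 s) :
    Achieves L (forLoop c bound P) (loopTime (forWeight c bound) N T) s (Inv N) := by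
  have hassign : Achieves L (.assign c (.lit 0) (.lit 0)) (Program.weight _) s
      fun s' => s' c 0 = 0 ∧ Inv 0 s' :=
    Achieves.of_safe hs (by simp [Program.Safe, Expr.eval])
      ⟨by simp [Program.exec, Expr.eval, Memory.write_apply], hcounter _ _ _ h⟩
  have hloop := fun s' (hs' : Bounded L s') (h' : s' c 0 = 0 ∧ Inv 0 s') =>
    Achieves.loop (L := L) (cond := .sub bound (scalar c))
      (P := .seq P (.assign c (.lit 0) (.add (scalar c) (.lit 1))))
      (T := T + (Program.assign c (.lit 0) (.add (scalar c) (.lit 1))).weight)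
      (fun k s => ∃ i, i + k = N ∧ s c 0 = i ∧ Inv i s)
      (by
        rintro k s hs ⟨i, hi, hc, hinv⟩ h0
        have hlt : i < N := by
          simp only [Expr.eval, hbound i s hinv, hc] at h0
          omega
        refine (hstep i hlt s hs hc hinv).seq fun s' hs' ⟨hc', hinv'⟩ => ?_
        have hlt' : i + 1 < 2 ^ L := lt_of_le_of_lt hlt hN
        refine Achieves.of_safe hs' (by simpa [Program.Safe, Expr.eval, hc'] using hlt')
          ⟨k - 1, by omega, i + 1, by omega, ?_, hcounter _ _ _ hinv'⟩
        simp [Program.exec, Expr.eval, hc', Memory.write_apply])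
      (N := N) hs' ⟨0, by omega, h'.1, h'.2⟩
  refine (hassign.seq hloop).mono ?_ ?_
  · simp only [loopTime, forWeight, Nat.cast_id]
    nlinarith
  · rintro s' _ ⟨h0, k, i, hi, hc, hinv⟩
    simp only [Expr.eval, hbound i s' hinv, hc] at h0
    obtain rfl : i = N := by omega
    exact hinv

end Machine

/-! ### The program

Besides the input (arrays `0`, `1`) and the output (array `2`), it uses the arrays
`3` maximal value, `4` precision, `5` logarithms, `6` weights, `7` least spending, `8` wealth,
`9` levels, `10` whether a good has been moved, `11` whether the program has finished,
`12`, `13` loop counters, `14`, `15` the current agent and good, `16`-`18` the current logarithm and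
the powers it belongs to, `19` the maximal wealth. -/

section Pieces

/-- The number of agents. -/
abbrev agents : Expr := .read 0 (.lit 0)

/-- The number of goods. -/
abbrev goods : Expr := .read 0 (.lit 1)

/-- The value of agent `a` for good `j`. -/
abbrev entry (a j : Expr) : Expr := .read 1 (.add (.mul a goods) j)

/-- Run through all pairs of an agent and a good. -/
def pairBody (P : Program) : Program :=
  .seq (.assign 14 (.lit 0) (.div (scalar 12) goods))
    (.seq (.assign 15 (.lit 0) (.sub (scalar 12) (.mul (scalar 14) goods))) P)

/-- Run `P` for all agents (in array `14`) and goods (in array `15`). -/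
def pairLoop (P : Program) : Program :=
  forLoop 12 (.mul agents goods) (pairBody P)

/-- The time of `pairLoop P` for `N` pairs. -/
def pairTime {R : Type*} [CommSemiring R] (P : Program) (N : R) : R :=
  loopTime (forWeight 12 (.mul agents goods)) N (((pairBody P).weight : ℕ) : R)

variable {n m L : ℕ}

lemma pair_lt (a : Fin n) (j : Fin m) : (a : ℕ) * m + j < n * m := by
  have h : ((a : ℕ) + 1) * m ≤ n * m := Nat.mul_le_mul_right m a.2
  have := j.2
  rw [add_mul] at h
  omega

lemma pair_div (a : Fin n) (j : Fin m) : ((a : ℕ) * m + j) / m = a := by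
  rw [mul_comm, Nat.mul_add_div j.pos, Nat.div_eq_of_lt j.2, add_zero]

lemma pair_lt_succ {a a' : Fin n} {j j' : Fin m} (h : (a' : ℕ) * m + j' < a * m + j + 1) :
    (a' : ℕ) * m + j' < a * m + j ∨ a' = a ∧ j' = j := by
  rcases Nat.lt_succ_iff_lt_or_eq.1 h with h | h
  · exact Or.inl h
  · right
    have h1 : a' = a := by
      have := congrArg (· / m) h
      simp only [pair_div] at this
      exact Fin.ext this
    subst h1
    exact ⟨rfl, Fin.ext (by omega)⟩

/-- One counter runs through `a * m + j`, and division recovers the pair. Thus no nested loop is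
needed, and the body can be treated by `exec`. -/
lemma Achieves.pairLoop {P : Program} (Inv : ℕ → Memory → Prop) (hL : n * m ≤ L)
    (hdim : ∀ i s, Inv i s → s 0 0 = n ∧ s 0 1 = m)
    (hscratch : ∀ i s s', (∀ b, b ≠ 12 → b ≠ 14 → b ≠ 15 → s' b = s b) → Inv i s → Inv i s')
    (hstep : ∀ (a : Fin n) (j : Fin m) s, Bounded L s → s 12 0 = a * m + j → s 14 0 = a →
      s 15 0 = j → Inv (a * m + j) s →
        P.Safe L s ∧ P.exec s 12 0 = a * m + j ∧ Inv (a * m + j + 1) (P.exec s))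
    {s : Memory} (hs : Bounded L s) (h : Inv 0 s) :
    Achieves L (pairLoop P) (pairTime P (n * m)) s (Inv (n * m)) := by
  refine Achieves.forLoop Inv (hL.trans_lt Nat.lt_two_pow_self) ?_ ?_ ?_ hs h
  · intro i s hi
    simp [Expr.eval, hdim i s hi]
  · exact fun i s w hi => hscratch i s _ (fun b hb _ _ => Memory.write_of_ne _ hb _ _) hi
  · intro i hi s hs h12 hinv
    have hm : 0 < m := Nat.pos_of_ne_zero fun h => by simp [h] at hi
    obtain ⟨a, j, rfl⟩ : ∃ (a : Fin n) (j : Fin m), i = a * m + j :=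
      ⟨⟨i / m, Nat.div_lt_of_lt_mul (by rwa [mul_comm])⟩, ⟨i % m, Nat.mod_lt _ hm⟩,
        by rw [mul_comm]; exact (Nat.div_add_mod i m).symm⟩
    have hdim' := hdim _ s hinv
    set s' := (s.write 14 0 a).write 15 0 j with hs'
    have hbound : ∀ k ≤ n * m, k < 2 ^ L := fun k hk => (hk.trans hL).trans_lt Nat.lt_two_pow_self
    have ha : (a : ℕ) < 2 ^ L := hbound _ (by have := pair_lt a j; nlinarith)
    have hj : (j : ℕ) < 2 ^ L := hbound _ (by have := pair_lt a j; nlinarith)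
    have hbs' : Bounded L s' := (hs.write ha _ _).write hj _ _
    obtain ⟨h1, h2, h3⟩ := hstep a j s' hbs' (by simp [hs', Memory.write_apply, h12])
      (by simp [hs', Memory.write_apply]) (by simp [hs', Memory.write_apply])
      (hscratch _ s s' (fun b _ h14 h15 => by simp [hs', Memory.write_of_ne, h14, h15]) hinv)
    have e : ∀ P : Program, P.exec s' = (pairBody P).exec s := by
      intro P
      simp [pairBody, Program.exec, Expr.eval, Memory.write_apply, hdim', h12, pair_div, hs']
    refine Achieves.of_safe hs ?_ ⟨by rw [← e]; exact h2, by rw [← e]; exact h3⟩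
    simp only [hs'] at h1
    simpa [pairBody, Program.Safe, Program.exec, Expr.eval, Memory.write_apply, hdim', h12,
      pair_div, ha, hj] using h1

/-- The memory `s` represents the instance `v`, the table `lam`, and the state `(x, f, σ)`. -/
structure Holds (v : Fin n → Fin m → ℕ) (lam : ℕ → ℕ) (x : Allocation n m) (f : Fin n → ℕ)
    (σ : ℕ) (s : Memory) : Prop where
  agents : s 0 0 = n
  goods : s 0 1 = m
  entry : ∀ (i : Fin n) (j : Fin m), s 1 (i * m + j) = v i j
  owner : ∀ j : Fin m, s 2 j = x j
  table : s 5 = lam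
  weight : ∀ i : Fin n, s 6 i = f i
  spending : s 7 0 = σ

variable {v : Fin n → Fin m → ℕ} {lam : ℕ → ℕ} {x : Allocation n m} {f : Fin n → ℕ} {σ : ℕ}

lemma Holds.congr {s s' : Memory} (h : Holds v lam x f σ s)
    (hs : ∀ b ∈ [0, 1, 2, 5, 6, 7], s' b = s b) : Holds v lam x f σ s' := by
  simp only [List.mem_cons, List.not_mem_nil, or_false, forall_eq_or_imp, forall_eq] at hs
  obtain ⟨h0, h1, h2, h5, h6, h7⟩ := hs
  exact ⟨h0 ▸ h.agents, h0 ▸ h.goods, h1 ▸ h.entry, h2 ▸ h.owner, h5 ▸ h.table, h6 ▸ h.weight,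
    h7 ▸ h.spending⟩

lemma Holds.write {s : Memory} (h : Holds v lam x f σ s) {a : ℕ} (ha : a ∉ [0, 1, 2, 5, 6, 7])
    (k w : ℕ) : Holds v lam x f σ (s.write a k w) :=
  h.congr fun b hb => Memory.write_of_ne _ (fun e : b = a => ha (e ▸ hb)) _ _

/-- All the numbers that occur in the main loop are at most `L`. -/
structure Large (v : Fin n → Fin m → ℕ) (K L : ℕ) : Prop where
  agents : n ≤ L
  goods : m ≤ L
  pairs : n * m ≤ L
  wealth : m * vmax v + 1 ≤ L
  spending : n * (K * (m * vmax v + 1)) + 1 ≤ L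

/-! ### Programs for wealth and levels -/

/-- Compute the wealth of all agents. -/
def wealthProgram : Program :=
  .seq (forLoop 12 agents (.assign 8 (scalar 12) (.lit 1)))
    (forLoop 12 goods (.assign 8 (.read 2 (scalar 12))
      (.add (.read 8 (.read 2 (scalar 12))) (entry (.read 2 (scalar 12)) (scalar 12)))))

/-- The time of `wealthProgram`. -/
def wealthTime {R : Type*} [CommSemiring R] (n m : R) : R :=
  loopTime (forWeight 12 agents) n (((Program.assign 8 (scalar 12) (.lit 1)).weight : ℕ) : R) +
  loopTime (forWeight 12 goods) m (((Program.assign 8 (.read 2 (scalar 12))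
      (.add (.read 8 (.read 2 (scalar 12))) (entry (.read 2 (scalar 12)) (scalar 12)))).weight
        : ℕ) : R)

lemma achieves_wealthProgram {K : ℕ} (hL : Large v K L) {s : Memory} (hs : Bounded L s)
    (h : Holds v lam x f σ s) :
    Achieves L wealthProgram (wealthTime n m) s
      fun s' => Holds v lam x f σ s' ∧ ∀ i : Fin n, s' 8 i = wealth v x i := by
  have h1 : 1 < 2 ^ L := lt_of_le_of_lt ((Nat.le_add_left 1 _).trans hL.wealth) Nat.lt_two_pow_self
  refine (Achieves.forLoop (N := n)
    (fun i s => Holds v lam x f σ s ∧ ∀ k : Fin n, (k : ℕ) < i → s 8 k = 1)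
    (hL.agents.trans_lt Nat.lt_two_pow_self) ?_ ?_ ?_ hs ⟨h, by simp⟩).seq ?_
  · exact fun i s hi => hi.1.agents
  · exact fun i s w hi => ⟨hi.1.write (by decide) _ _, by simpa [Memory.write_apply] using hi.2⟩
  · rintro i hi s hs h12 ⟨h, hk⟩
    refine Achieves.of_safe hs (by simpa [Program.Safe, Expr.eval] using h1) ⟨?_, ?_, ?_⟩
    · simp [Program.exec, Memory.write_apply, h12]
    · exact h.write (by decide) _ _
    · intro k hki
      simp only [Program.exec, Expr.eval, Memory.write_apply, h12, true_and]
      split_ifs with h'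
      · rfl
      · exact hk k (by omega)
  · rintro s hs ⟨h, hk⟩
    refine (Achieves.forLoop (N := m) (fun i s => Holds v lam x f σ s ∧ ∀ k : Fin n,
      s 8 k = ∑ j ∈ (bundle x k).filter (fun j : Fin m => (j : ℕ) < i), v k j + 1)
      (hL.goods.trans_lt Nat.lt_two_pow_self) ?_ ?_ ?_ hs ⟨h, by simp [hk]⟩).mono le_rfl ?_
    · exact fun i s hi => hi.1.goods
    · exact fun i s w hi => ⟨hi.1.write (by decide) _ _, by simpa [Memory.write_apply] using hi.2⟩
    · rintro i hi s hs h12 ⟨h, hk⟩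
      have hx : s 2 i = x ⟨i, hi⟩ := h.owner ⟨i, hi⟩
      have hv : s 1 (x ⟨i, hi⟩ * m + i) = v (x ⟨i, hi⟩) ⟨i, hi⟩ := h.entry _ ⟨i, hi⟩
      -- Passing from `i` to `i + 1` adds good `i` to the partial sum of its owner only.
      have hstep : ∀ k : Fin n, ∑ j ∈ (bundle x k).filter (fun j : Fin m => (j : ℕ) < i + 1), v k j =
          ∑ j ∈ (bundle x k).filter (fun j : Fin m => (j : ℕ) < i), v k j +
            if k = x ⟨i, hi⟩ then v k ⟨i, hi⟩ else 0 := by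
        intro k
        have e : (bundle x k).filter (fun j : Fin m => (j : ℕ) < i + 1) =
            (bundle x k).filter (fun j : Fin m => (j : ℕ) < i) ∪
              (bundle x k).filter (fun j => j = ⟨i, hi⟩) := by
          ext j
          simp only [Finset.mem_filter, Finset.mem_union, Fin.ext_iff, Nat.lt_succ_iff_lt_or_eq]
          tauto
        rw [e, Finset.sum_union, Finset.filter_eq']
        · congr 1
          simp only [bundle, Finset.mem_filter, Finset.mem_univ, true_and, eq_comm]
          split_ifs <;> simp
        · rw [Finset.disjoint_left]
          intro j hj hj'
          rw [Finset.mem_filter] at hj hj'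
          rw [hj'.2] at hj
          exact lt_irrefl _ hj.2
      have hnew := hstep (x ⟨i, hi⟩)
      rw [if_pos rfl] at hnew
      refine Achieves.of_safe hs ?_ ⟨?_, ?_, ?_⟩
      · have hle : ∑ j ∈ (bundle x (x ⟨i, hi⟩)).filter (fun j : Fin m => (j : ℕ) < i + 1),
            v (x ⟨i, hi⟩) j ≤ m * vmax v := value_le v (x ⟨i, hi⟩) _
        simp only [Program.Safe, Expr.eval, h12, hx, h.goods, hv, hk]
        have := hL.wealth
        exact lt_of_le_of_lt (by omega) Nat.lt_two_pow_self
      · simp [Program.exec, Memory.write_apply, h12]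
      · exact h.write (by decide) _ _
      · intro k
        simp only [Program.exec, Expr.eval, Memory.write_apply, h12, hx, h.goods, hv, hk, true_and,
          hstep k, ← Fin.ext_iff]
        split_ifs with h'
        · subst h'
          omega
        · omega
    · rintro s' _ ⟨h, hk⟩
      refine ⟨h, fun k => ?_⟩
      rw [hk k, Finset.filter_true_of_mem fun j _ => j.2]
      rfl

/-- A nonzero value means that the offer of agent `a` for good `j` is tight. -/
abbrev tightTest : Expr :=
  .mul (entry (scalar 14) (scalar 15))
    (.sub (.add (.lit 1) (.add (.read 6 (scalar 14)) (.read 5 (entry (scalar 14) (scalar 15)))))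
      (.add (.read 6 (.read 2 (scalar 15)))
        (.read 5 (entry (.read 2 (scalar 15)) (scalar 15)))))

/-- Tests encode conjunction by a product and `b ≤ c` by the truncated difference `1 + c - b` being
nonzero. -/
lemma Holds.tightTest_ne_zero {s : Memory} (h : Holds v lam x f σ s) {a : Fin n} {j : Fin m}
    (ha : s 14 0 = a) (hj : s 15 0 = j) :
    tightTest.eval s ≠ 0 ↔ Tight v lam x f a j := by
  simp only [Expr.eval, ha, hj, h.goods, h.entry, h.weight, h.owner, h.table, Tight, bid, ne_eq,
    mul_eq_zero, not_or]
  omega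

/-- One round of the breadth-first search. -/
def levelBody : Program :=
  .branch (.mul tightTest (.mul (.sub (.add (scalar 13) (.lit 1)) (.read 9 (scalar 14)))
      (.sub (.read 9 (.read 2 (scalar 15))) (.add (scalar 13) (.lit 1)))))
    (.assign 9 (.read 2 (scalar 15)) (.add (scalar 13) (.lit 1))) .skip

/-- Mark the poorest agents. -/
def levelInit : Program :=
  .branch (.sub (.add (.read 6 (scalar 12)) (.read 5 (.read 8 (scalar 12)))) (scalar 7))
    (.assign 9 (scalar 12) agents) (.assign 9 (scalar 12) (.lit 0))

/-- Compute the levels of all agents. -/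
def levelProgram : Program :=
  .seq (forLoop 12 agents levelInit) (forLoop 13 agents (pairLoop levelBody))

/-- The time of `levelProgram`. -/
def levelTime {R : Type*} [CommSemiring R] (n m : R) : R :=
  loopTime (forWeight 12 agents) n ((levelInit.weight : ℕ) : R) +
  loopTime (forWeight 13 agents) n (pairTime levelBody (n * m))

-- Labels are written in place, yet one pass performs exactly one round: only agents with label at
-- most `t` pass the search on, while new labels are `t + 1`. Unreached agents carry `n`; in the
-- last round the new label is `n` as well, which agrees with `level`.
open Classical in
lemma achieves_levelBody {K : ℕ} (hL : Large v K L) {t : ℕ} (ht : t < n) {s : Memory}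
    (hs : Bounded L s) (h : Holds v lam x f σ s) (hu : ∀ i : Fin n, s 8 i = wealth v x i)
    (h13 : s 13 0 = t)
    (hlev : ∀ k : Fin n, s 9 k = if k ∈ reach v lam x f σ t then level v lam x f σ k else n) :
    Achieves L (pairLoop levelBody) (pairTime levelBody (n * m)) s fun s' =>
      s' 13 0 = t ∧ Holds v lam x f σ s' ∧ (∀ i : Fin n, s' 8 i = wealth v x i) ∧
      ∀ k : Fin n, s' 9 k = if k ∈ reach v lam x f σ (t + 1) then level v lam x f σ k else n := by
  refine (Achieves.pairLoop (n := n) (m := m) (fun i s => s 13 0 = t ∧ Holds v lam x f σ s ∧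
    (∀ i : Fin n, s 8 i = wealth v x i) ∧
    ∀ k : Fin n, s 9 k = if k ∈ reach v lam x f σ t then level v lam x f σ k else
      if ∃ a ∈ reach v lam x f σ t, ∃ j : Fin m, (a : ℕ) * m + j < i ∧ x j = k ∧
        Tight v lam x f a j then t + 1 else n) hL.pairs ?_ ?_ ?_ hs ?_).mono le_rfl ?_
  · exact fun i s hi => ⟨hi.2.1.agents, hi.2.1.goods⟩
  · rintro i s s' hb ⟨h13, h, hu, hlev⟩
    exact ⟨by rw [hb 13 (by decide) (by decide) (by decide)]; exact h13,
      h.congr (by simp [hb]), by simpa [hb] using hu, by simpa [hb] using hlev⟩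
  · rintro a j s hs h12 ha hj ⟨h13, h, hu, hlev⟩
    have htight := h.tightTest_ne_zero ha hj
    have hlevel : ∀ k, k ∈ reach v lam x f σ t → level v lam x f σ k ≤ t := fun k hk =>
      (level_le_iff ht).2 hk
    have hda : 0 < t + 1 - s 9 a ↔ a ∈ reach v lam x f σ t := by
      rw [hlev a]
      split_ifs with h1 h2
      · have := hlevel a h1
        simp only [h1, iff_true]
        omega
      · simp [h1]
      · simp only [h1, iff_false]
        omega
    have hcond : Expr.eval s (.mul tightTest
        (.mul (.sub (.add (scalar 13) (.lit 1)) (.read 9 (scalar 14)))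
        (.sub (.read 9 (.read 2 (scalar 15))) (.add (scalar 13) (.lit 1))))) ≠ 0 ↔
        (Tight v lam x f a j ∧ a ∈ reach v lam x f σ t) ∧ t + 1 < s 9 (x j) := by
      rw [← htight, ← hda]
      generalize tightTest = e
      simp only [Expr.eval, ha, hj, h13, h.owner, ne_eq, mul_eq_zero, not_or]
      omega
    have hexists : ∀ k : Fin n, (∃ a' ∈ reach v lam x f σ t, ∃ j' : Fin m,
        (a' : ℕ) * m + j' < a * m + j + 1 ∧ x j' = k ∧ Tight v lam x f a' j') ↔
        (∃ a' ∈ reach v lam x f σ t, ∃ j' : Fin m,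
        (a' : ℕ) * m + j' < a * m + j ∧ x j' = k ∧ Tight v lam x f a' j') ∨
        (x j = k ∧ Tight v lam x f a j ∧ a ∈ reach v lam x f σ t) := by
      intro k
      constructor
      · rintro ⟨a', h1, j', h2, h3, h4⟩
        rcases pair_lt_succ h2 with h5 | ⟨rfl, rfl⟩
        · exact Or.inl ⟨a', h1, j', h5, h3, h4⟩
        · exact Or.inr ⟨h3, h4, h1⟩
      · rintro (⟨a', h1, j', h2, h3, h4⟩ | ⟨h1, h2, h3⟩)
        · exact ⟨a', h1, j', by omega, h3, h4⟩
        · exact ⟨a, h3, j, by omega, h1, h2⟩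
    have ht1 : t + 1 < 2 ^ L := lt_of_le_of_lt (Nat.succ_le_of_lt ht |>.trans hL.agents) Nat.lt_two_pow_self
    refine ⟨⟨fun _ => by simpa [Program.Safe, Expr.eval, h13] using ht1, fun _ => trivial⟩, ?_⟩
    simp only [levelBody, Program.exec]
    by_cases hc : (Tight v lam x f a j ∧ a ∈ reach v lam x f σ t) ∧ t + 1 < s 9 (x j)
    · rw [if_neg (hcond.2 hc)]
      simp only [Expr.eval, hj, h.owner, h13]
      refine ⟨by simp [Memory.write_apply, h12], by simp [Memory.write_apply, h13],
        h.write (by decide) _ _, by simpa [Memory.write_apply] using hu, fun k => ?_⟩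
      simp only [Memory.write_apply, true_and, ← Fin.ext_iff, hexists]
      by_cases hk : k = x j
      · subst hk
        have h1 : x j ∉ reach v lam x f σ t := by
          intro h1
          have h2 := hc.2
          rw [hlev, if_pos h1] at h2
          have := hlevel _ h1
          omega
        rw [if_pos rfl, if_neg h1, if_pos (Or.inr ⟨rfl, hc.1⟩)]
      · rw [if_neg hk, hlev]
        have : ¬ x j = k := fun e => hk e.symm
        simp [this]
    · rw [if_pos (not_not.1 (mt hcond.1 hc))]
      refine ⟨h12, h13, h, hu, fun k => ?_⟩
      simp only [hexists]
      by_cases hk : x j = k ∧ Tight v lam x f a j ∧ a ∈ reach v lam x f σ t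
      · obtain ⟨rfl, hk⟩ := hk
        have h1 : ¬ t + 1 < s 9 (x j) := fun h' => hc ⟨hk, h'⟩
        rw [hlev] at h1 ⊢
        simp only [hk, and_self, or_true, if_true]
        split_ifs at h1 ⊢
        · rfl
        · rfl
        · omega
      · rw [hlev]
        simp only [hk, or_false]
  · refine ⟨h13, h, hu, fun k => ?_⟩
    rw [hlev]
    simp
  · rintro s' _ ⟨h13, h, hu, hlev⟩
    refine ⟨h13, h, hu, fun k => ?_⟩
    rw [hlev]
    by_cases h1 : k ∈ reach v lam x f σ t
    · rw [if_pos h1, if_pos (reach_mono (Nat.le_succ t) h1)]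
    · rw [if_neg h1]
      by_cases h2 : k ∈ reach v lam x f σ (t + 1)
      · rw [if_pos h2, if_pos, level_eq_succ ht h2 h1]
        obtain ⟨a, ha, j, hj, htight⟩ := (mem_reach_succ.1 h2).resolve_left h1
        exact ⟨a, ha, j, pair_lt a j, hj, htight⟩
      · rw [if_neg h2, if_neg]
        rintro ⟨a, ha, j, _, hj, htight⟩
        exact h2 (mem_reach_succ.2 (Or.inr ⟨a, ha, j, hj, htight⟩))

lemma achieves_levelProgram {K : ℕ} (hL : Large v K L) {s : Memory} (hs : Bounded L s)
    (h : Holds v lam x f σ s) (hu : ∀ i : Fin n, s 8 i = wealth v x i) :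
    Achieves L levelProgram (levelTime n m) s fun s' => Holds v lam x f σ s' ∧
      (∀ i : Fin n, s' 8 i = wealth v x i) ∧ ∀ k : Fin n, s' 9 k = level v lam x f σ k := by
  classical
  have hn : n < 2 ^ L := hL.agents.trans_lt Nat.lt_two_pow_self
  refine (Achieves.forLoop (N := n) (fun i s => Holds v lam x f σ s ∧
    (∀ i : Fin n, s 8 i = wealth v x i) ∧
    ∀ k : Fin n, (k : ℕ) < i → s 9 k = if k ∈ reach v lam x f σ 0 then level v lam x f σ k else n)
    hn ?_ ?_ ?_ hs ⟨h, hu, by simp⟩).seq ?_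
  · exact fun i s hi => hi.1.agents
  · exact fun i s w hi => ⟨hi.1.write (by decide) _ _, by simpa [Memory.write_apply] using hi.2.1,
      by simpa [Memory.write_apply] using hi.2.2⟩
  · rintro i hi s hs h12 ⟨h, hu, hk⟩
    have hu' : s 8 i = wealth v x ⟨i, hi⟩ := hu ⟨i, hi⟩
    have hf' : s 6 i = f ⟨i, hi⟩ := h.weight ⟨i, hi⟩
    have hcond : Expr.eval s (.sub (.add (.read 6 (scalar 12)) (.read 5 (.read 8 (scalar 12))))
        (scalar 7)) = 0 ↔ level v lam x f σ ⟨i, hi⟩ = 0 := by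
      simp only [Expr.eval, h12, hu', hf', h.table, h.spending, level_eq_zero]
      omega
    refine Achieves.of_safe hs ?_ ?_
    · exact ⟨fun _ => by simpa [Program.Safe, Expr.eval, h.agents] using hn,
        fun _ => by simp [Program.Safe, Expr.eval]⟩
    · simp only [levelInit, Program.exec]
      by_cases hc : level v lam x f σ ⟨i, hi⟩ = 0
      · rw [if_pos (hcond.2 hc)]
        refine ⟨by simp [Memory.write_apply, h12], h.write (by decide) _ _,
          by simpa [Memory.write_apply] using hu, fun k hki => ?_⟩
        simp only [Expr.eval, Memory.write_apply, h12, true_and]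
        split_ifs with h1 h2 h2
        · obtain rfl : k = ⟨i, hi⟩ := Fin.ext h1
          exact hc.symm
        · obtain rfl : k = ⟨i, hi⟩ := Fin.ext h1
          rw [mem_reach_zero, ← level_eq_zero] at h2
          exact absurd hc h2
        · rw [hk k (by omega), if_pos h2]
        · rw [hk k (by omega), if_neg h2]
      · rw [if_neg (mt hcond.1 hc)]
        refine ⟨by simp [Memory.write_apply, h12], h.write (by decide) _ _,
          by simpa [Memory.write_apply] using hu, fun k hki => ?_⟩
        simp only [Expr.eval, Memory.write_apply, h12, h.agents, true_and]
        split_ifs with h1 h2 h2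
        · obtain rfl : k = ⟨i, hi⟩ := Fin.ext h1
          rw [mem_reach_zero, ← level_eq_zero] at h2
          exact absurd h2 hc
        · rfl
        · rw [hk k (by omega), if_pos h2]
        · rw [hk k (by omega), if_neg h2]
  · rintro s hs ⟨h, hu, hk⟩
    refine (Achieves.forLoop (N := n) (fun t s => Holds v lam x f σ s ∧
      (∀ i : Fin n, s 8 i = wealth v x i) ∧
      ∀ k : Fin n, s 9 k = if k ∈ reach v lam x f σ t then level v lam x f σ k else n)
      hn ?_ ?_ ?_ hs ⟨h, hu, fun k => hk k k.2⟩).mono le_rfl ?_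
    · exact fun i s hi => hi.1.agents
    · exact fun i s w hi => ⟨hi.1.write (by decide) _ _,
        by simpa [Memory.write_apply] using hi.2.1, by simpa [Memory.write_apply] using hi.2.2⟩
    · rintro t ht s hs h13 ⟨h, hu, hlev⟩
      exact achieves_levelBody hL ht hs h hu h13 hlev
    · rintro s' _ ⟨h, hu, hlev⟩
      refine ⟨h, hu, fun k => ?_⟩
      rw [hlev]
      split_ifs with h1
      · rfl
      -- A level below `n` would put `k` into `reach (n - 1)`.
      · by_contra h2
        have h3 := level_le_card (v := v) (lam := lam) (x := x) (f := f) (σ := σ) (k := k)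
        have h4 := level_lt_iff.1 (lt_of_le_of_ne h3 (Ne.symm h2))
        exact h1 (reach_mono (Nat.sub_le _ _) h4)

end Pieces

/-! ### One iteration and the main loop -/

section MainLoop

variable {n m L : ℕ} {v : Fin n → Fin m → ℕ} {lam : ℕ → ℕ} {x : Allocation n m} {f : Fin n → ℕ}
  {σ : ℕ}

/-- Move the current good to the current agent if no good has been moved and this is allowed. -/
def moveBody : Program :=
  .branch (.mul (.sub (.lit 1) (scalar 10)) (.mul tightTest
      (.mul (.sub (.read 9 (.read 2 (scalar 15))) (.read 9 (scalar 14)))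
        (.sub (.add (.read 6 (.read 2 (scalar 15))) (.read 5 (.sub (.read 8 (.read 2 (scalar 15)))
          (entry (.read 2 (scalar 15)) (scalar 15))))) (scalar 7)))))
    (.seq (.assign 10 (.lit 0) (.lit 1)) (.assign 2 (scalar 15) (scalar 14))) .skip

/-- Move a good if this is allowed for any. -/
def moveProgram : Program :=
  .seq (.assign 10 (.lit 0) (.lit 0)) (pairLoop moveBody)

/-- The time of `moveProgram`. -/
def moveTime {R : Type*} [CommSemiring R] (n m : R) : R :=
  (((Program.assign 10 (.lit 0) (.lit 0)).weight : ℕ) : R) + pairTime moveBody (n * m)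

lemma Holds.update {s : Memory} (h : Holds v lam x f σ s) (a : Fin n) (j : Fin m) :
    Holds v lam (Function.update x j a) f σ (s.write 2 j a) where
  agents := h.agents
  goods := h.goods
  entry := h.entry
  owner j' := by
    rw [Memory.write_apply, Function.update_apply]
    simp only [true_and, ← Fin.ext_iff]
    split_ifs
    · rfl
    · exact h.owner j'
  table := h.table
  weight := h.weight
  spending := h.spending

lemma achieves_moveProgram {K : ℕ} (hL : Large v K L) {s : Memory} (hs : Bounded L s)
    (h : Holds v lam x f σ s) (hu : ∀ i : Fin n, s 8 i = wealth v x i)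
    (hlev : ∀ k : Fin n, s 9 k = level v lam x f σ k) :
    Achieves L moveProgram (moveTime n m) s fun s' =>
      (s' 10 0 = 0 ∧ Holds v lam x f σ s' ∧ (∀ k : Fin n, s' 9 k = level v lam x f σ k) ∧
        ∀ a j, ¬ Movable v lam x f σ a j) ∨
      (s' 10 0 = 1 ∧ ∃ a j, Movable v lam x f σ a j ∧
        Holds v lam (Function.update x j a) f σ s') := by
  have h1 : 1 < 2 ^ L := lt_of_le_of_lt ((Nat.le_add_left 1 _).trans hL.wealth) Nat.lt_two_pow_self
  have hfirst : Achieves L (.assign 10 (.lit 0) (.lit 0)) (Program.weight _) s fun s' =>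
      s' 10 0 = 0 ∧ Holds v lam x f σ s' ∧ (∀ i : Fin n, s' 8 i = wealth v x i) ∧
        ∀ k : Fin n, s' 9 k = level v lam x f σ k :=
    Achieves.of_safe hs (by simp [Program.Safe, Expr.eval])
      ⟨by simp [Program.exec, Expr.eval, Memory.write_apply], h.write (by decide) _ _,
        by simpa [Program.exec, Expr.eval, Memory.write_apply] using hu,
        by simpa [Program.exec, Expr.eval, Memory.write_apply] using hlev⟩
  refine hfirst.seq fun s hs ⟨h10, h, hu, hlev⟩ => ?_
  -- The flag in array `10` blocks any second move. Stored wealth and levels are out of date after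
  -- the first, so the second alternative does not mention them.
  refine (Achieves.pairLoop (n := n) (m := m) (fun i s =>
    (s 10 0 = 0 ∧ Holds v lam x f σ s ∧ (∀ i : Fin n, s 8 i = wealth v x i) ∧
      (∀ k : Fin n, s 9 k = level v lam x f σ k) ∧
      ∀ (a : Fin n) (j : Fin m), (a : ℕ) * m + j < i → ¬ Movable v lam x f σ a j) ∨
    (s 10 0 = 1 ∧ ∃ a j, Movable v lam x f σ a j ∧ Holds v lam (Function.update x j a) f σ s))
    hL.pairs ?_ ?_ ?_ hs (Or.inl ⟨h10, h, hu, hlev, by simp⟩)).mono le_rfl ?_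
  · rintro i s (hi | ⟨_, _, _, _, hi⟩)
    · exact ⟨hi.2.1.agents, hi.2.1.goods⟩
    · exact ⟨hi.agents, hi.goods⟩
  · rintro i s s' hb (⟨h10, h, hu, hlev, hmov⟩ | ⟨h10, a, j, hmov, h⟩)
    · exact Or.inl ⟨by rw [hb 10 (by decide) (by decide) (by decide)]; exact h10,
        h.congr (by simp [hb]), by simpa [hb] using hu, by simpa [hb] using hlev, hmov⟩
    · exact Or.inr ⟨by rw [hb 10 (by decide) (by decide) (by decide)]; exact h10,
        a, j, hmov, h.congr (by simp [hb])⟩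
  · rintro a j s hs h12 ha hj (⟨h10, h, hu, hlev, hmov⟩ | ⟨h10, a', j', hmov, h⟩)
    · have htight := h.tightTest_ne_zero ha hj
      have hcond : Expr.eval s (.mul (.sub (.lit 1) (scalar 10)) (.mul tightTest
          (.mul (.sub (.read 9 (.read 2 (scalar 15))) (.read 9 (scalar 14)))
          (.sub (.add (.read 6 (.read 2 (scalar 15))) (.read 5 (.sub (.read 8 (.read 2 (scalar 15)))
          (entry (.read 2 (scalar 15)) (scalar 15))))) (scalar 7))))) ≠ 0 ↔
          Movable v lam x f σ a j := by
        rw [Movable, ← htight]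
        generalize tightTest = e
        simp only [Expr.eval, ha, hj, h10, h.owner, hlev, hu, h.weight, h.table, h.spending,
          h.goods, h.entry, ne_eq, mul_eq_zero, not_or]
        omega
      refine ⟨⟨fun _ => ⟨by simpa [Program.Safe, Expr.eval] using h1, ?_⟩, fun _ => trivial⟩, ?_⟩
      · simp only [Program.Safe, Program.exec, Expr.eval, Memory.write_apply]
        norm_num
        exact hs _ _
      simp only [moveBody, Program.exec]
      by_cases hc : Movable v lam x f σ a j
      · rw [if_neg (hcond.2 hc)]
        refine ⟨by simp [Memory.write_apply, h12], Or.inr ⟨by simp [Expr.eval, Memory.write_apply],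
          a, j, hc, ?_⟩⟩
        have e1 : Expr.eval (s.write 10 (Expr.eval s (.lit 0)) (Expr.eval s (.lit 1)))
            (scalar 15) = j := by simp [Expr.eval, Memory.write_apply, hj]
        have e2 : Expr.eval (s.write 10 (Expr.eval s (.lit 0)) (Expr.eval s (.lit 1)))
            (scalar 14) = a := by simp [Expr.eval, Memory.write_apply, ha]
        rw [e1, e2]
        exact (h.write (by decide) _ _).update a j
      · rw [if_pos (not_not.1 (mt hcond.1 hc))]
        refine ⟨h12, Or.inl ⟨h10, h, hu, hlev, fun a' j' hlt => ?_⟩⟩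
        rcases pair_lt_succ hlt with hlt | ⟨rfl, rfl⟩
        · exact hmov a' j' hlt
        · exact hc
    · have hcond : ∀ e, Expr.eval s (.mul (.sub (.lit 1) (scalar 10)) e) = 0 := by
        intro e
        simp [Expr.eval, h10]
      refine ⟨⟨fun h0 => absurd (hcond _) h0, fun _ => trivial⟩, ?_⟩
      simp only [moveBody, Program.exec]
      rw [if_pos (hcond _)]
      exact ⟨h12, Or.inr ⟨h10, a', j', hmov, h⟩⟩
  · rintro s' _ (⟨h10, h, hu, hlev, hmov⟩ | h)
    · exact Or.inl ⟨h10, h, hlev, fun a j => hmov a j (pair_lt a j)⟩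
    · exact Or.inr h

/-- Raise the weight of the current agent if it is within reach. -/
def raiseBody : Program :=
  .branch (.sub agents (.read 9 (scalar 12)))
    (.assign 6 (scalar 12) (.add (.read 6 (scalar 12)) (.lit 1))) (.assign 11 (.lit 0) (.lit 0))

/-- Raise the weights of the agents within reach; finish if these are all agents. -/
def raiseProgram : Program :=
  .seq (.assign 11 (.lit 0) (.lit 1)) (.seq (forLoop 12 agents raiseBody)
    (.assign 7 (.lit 0) (.add (scalar 7) (.lit 1))))

/-- The time of `raiseProgram`. -/
def raiseTime {R : Type*} [CommSemiring R] (n : R) : R :=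
  (((Program.assign 11 (.lit 0) (.lit 1)).weight : ℕ) : R) +
    (loopTime (forWeight 12 agents) n ((raiseBody.weight : ℕ) : R) +
      (((Program.assign 7 (.lit 0) (.add (scalar 7) (.lit 1))).weight : ℕ) : R))

lemma achieves_raiseProgram {K : ℕ} (hL : Large v K L)
    (hσ : σ ≤ n * (K * (m * vmax v + 1))) (hf : ∀ i, f i ≤ σ) {s : Memory} (hs : Bounded L s)
    (h : Holds v lam x f σ s) (hlev : ∀ k : Fin n, s 9 k = level v lam x f σ k) :
    Achieves L raiseProgram (raiseTime n) s fun s' =>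
      Holds v lam x (raise v lam x f σ) (σ + 1) s' ∧
        ((s' 11 0 = 1 ∧ ∀ k, level v lam x f σ k < n) ∨
          (s' 11 0 = 0 ∧ ∃ k, ¬ level v lam x f σ k < n)) := by
  have h1 : 1 < 2 ^ L := lt_of_le_of_lt ((Nat.le_add_left 1 _).trans hL.wealth) Nat.lt_two_pow_self
  have hσ1 : σ + 1 < 2 ^ L :=
    lt_of_le_of_lt ((Nat.succ_le_succ hσ).trans hL.spending) Nat.lt_two_pow_self
  have hfirst : Achieves L (.assign 11 (.lit 0) (.lit 1)) (Program.weight _) s fun s' =>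
      s' 11 0 = 1 ∧ Holds v lam x f σ s' ∧ ∀ k : Fin n, s' 9 k = level v lam x f σ k :=
    Achieves.of_safe hs (by simpa [Program.Safe, Expr.eval] using h1)
      ⟨by simp [Program.exec, Expr.eval, Memory.write_apply], h.write (by decide) _ _,
        by simpa [Program.exec, Expr.eval, Memory.write_apply] using hlev⟩
  refine hfirst.seq fun s hs ⟨h11, h, hlev⟩ => ?_
  -- Midway the exponents are mixed: raised for agents below `i`, old for the others.
  refine (Achieves.forLoop (N := n) (fun i s =>
    Holds v lam x (fun k => if (k : ℕ) < i then raise v lam x f σ k else f k) σ s ∧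
    (∀ k : Fin n, s 9 k = level v lam x f σ k) ∧
    ((s 11 0 = 1 ∧ ∀ k : Fin n, (k : ℕ) < i → level v lam x f σ k < n) ∨
          (s 11 0 = 0 ∧ ∃ k, ¬ level v lam x f σ k < n)))
    (hL.agents.trans_lt Nat.lt_two_pow_self) ?_ ?_ ?_ hs
    ⟨by simpa using h, hlev, Or.inl ⟨h11, by simp⟩⟩).seq ?_
  · exact fun i s hi => hi.1.agents
  · exact fun i s w hi => ⟨hi.1.write (by decide) _ _,
      by simpa [Memory.write_apply] using hi.2.1, by simpa [Memory.write_apply] using hi.2.2⟩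
  · rintro i hi s hs h12 ⟨h, hlev, h11⟩
    have hlev' : s 9 i = level v lam x f σ ⟨i, hi⟩ := hlev ⟨i, hi⟩
    have hf' : s 6 i = f ⟨i, hi⟩ := by simpa using h.weight ⟨i, hi⟩
    have hcond : Expr.eval s (.sub agents (.read 9 (scalar 12))) = 0 ↔
        ¬ level v lam x f σ ⟨i, hi⟩ < n := by
      simp only [Expr.eval, h12, h.agents, hlev']
      omega
    refine Achieves.of_safe (P := raiseBody) hs
      ⟨fun _ => ?_, fun _ => by simp [Program.Safe, Expr.eval]⟩ ?_
    · simp only [Program.Safe, Expr.eval, h12, hf']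
      have := hf ⟨i, hi⟩
      omega
    simp only [raiseBody, Program.exec]
    by_cases hc : level v lam x f σ ⟨i, hi⟩ < n
    · rw [if_neg (fun h0 => hcond.1 h0 hc)]
      simp only [Expr.eval, h12, hf']
      refine ⟨by simp [Memory.write_apply, h12], ⟨h.agents, h.goods, h.entry, h.owner, h.table,
        fun k => ?_, h.spending⟩, by simpa [Memory.write_apply] using hlev, ?_⟩
      · simp only [Memory.write_apply, true_and]
        split_ifs with h2 h3 h3
        · obtain rfl : k = ⟨i, hi⟩ := Fin.ext h2
          rw [raise, if_pos hc]
        · omega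
        · rw [h.weight, if_pos (by omega)]
        · rw [h.weight, if_neg (by omega)]
      · rcases h11 with ⟨h11, hk⟩ | h11
        · refine Or.inl ⟨by simpa [Memory.write_apply] using h11, fun k hki => ?_⟩
          rcases Nat.lt_succ_iff_lt_or_eq.1 hki with h2 | h2
          · exact hk k h2
          · obtain rfl : k = ⟨i, hi⟩ := Fin.ext h2
            exact hc
        · exact Or.inr (by simpa [Memory.write_apply] using h11)
    · rw [if_pos (hcond.2 hc)]
      simp only [Expr.eval]
      refine ⟨by simp [Memory.write_apply, h12], ⟨h.agents, h.goods, h.entry, h.owner, h.table,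
        fun k => ?_, h.spending⟩, by simpa [Memory.write_apply] using hlev,
        Or.inr ⟨by simp [Memory.write_apply], _, hc⟩⟩
      simp only [Memory.write_of_ne s (show 6 ≠ 11 by decide), h.weight]
      split_ifs with h2 h3 h3
      · rfl
      · omega
      · obtain rfl : k = ⟨i, hi⟩ := Fin.ext (by simp; omega)
        rw [raise, if_neg hc]
      · rfl
  · rintro s hs ⟨h, hlev, h11⟩
    have h' : Holds v lam x (raise v lam x f σ) σ s := by simpa using h
    refine Achieves.of_safe hs (by simpa [Program.Safe, Expr.eval, h.spending] using hσ1) ⟨?_, ?_⟩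
    · simp only [Program.exec, Expr.eval, h.spending]
      exact ⟨h'.agents, h'.goods, h'.entry, h'.owner, h'.table, h'.weight,
        by simp [Memory.write_apply]⟩
    · simpa [Program.exec, Expr.eval, Memory.write_apply] using h11

/-- One iteration of the algorithm. -/
def iteration : Program :=
  .seq wealthProgram (.seq levelProgram (.seq moveProgram
    (.branch (scalar 10) (.assign 11 (.lit 0) (.lit 0)) raiseProgram)))

/-- The time of `iteration`. -/
def iterationTime {R : Type*} [CommSemiring R] (n m : R) : R :=
  wealthTime n m + (levelTime n m + (moveTime n m +
    (((1 + (scalar 10).weight + (Program.assign 11 (.lit 0) (.lit 0)).weight : ℕ) : R) +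
      raiseTime n)))

/-- The goods are allocated in an envy-free up to one good and Pareto optimal way. -/
def Solved (v : Fin n → Fin m → ℕ) (s : Memory) : Prop :=
  ∃ x : Allocation n m, (∀ j : Fin m, s 2 j = x j) ∧ IsEF1 v x ∧ IsPO v x

lemma achieves_iteration (hL : Large v (4 * (m * vmax v + 1) ^ 2) L)
    (hlam : IsLogTable (4 * (m * vmax v + 1) ^ 2) (m * vmax v + 1) lam) (hx : Valid v lam x f σ)
    {s : Memory} (hs : Bounded L s) (h : Holds v lam x f σ s) :
    Achieves L iteration (iterationTime n m) s fun s' =>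
      (s' 11 0 = 0 ∧ ∃ x' f' σ', Valid v lam x' f' σ' ∧ Holds v lam x' f' σ' s' ∧
        measure v lam (n * (4 * (m * vmax v + 1) ^ 2 * (m * vmax v + 1))) x' f' σ' <
          measure v lam (n * (4 * (m * vmax v + 1) ^ 2 * (m * vmax v + 1))) x f σ) ∨
      (s' 11 0 = 1 ∧ Solved v s') := by
  have hK : 0 < 4 * (m * vmax v + 1) ^ 2 := by positivity
  refine (achieves_wealthProgram hL hs h).seq fun s hs ⟨h, hu⟩ => ?_
  refine (achieves_levelProgram hL hs h hu).seq fun s hs ⟨h, hu, hlev⟩ => ?_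
  refine (achieves_moveProgram hL hs h hu hlev).seq fun s hs hor => ?_
  refine Achieves.branch (T := (Program.assign 11 (.lit 0) (.lit 0)).weight) (T' := raiseTime n)
    hs (fun h0 => ?_) fun h0 => ?_
  · rcases hor with ⟨h10, -⟩ | ⟨h10, a, j, hmov, h⟩
    · exact absurd h10 h0
    · refine Achieves.of_safe hs (by simp [Program.Safe, Expr.eval]) (Or.inl
        ⟨by simp [Program.exec, Expr.eval, Memory.write_apply], _, _, _, hx.move hK hlam hmov,
          h.write (by decide) _ _, hx.measure_move_lt hK hlam hmov _⟩)
  · rcases hor with ⟨h10, h, hlev, hmov⟩ | ⟨h10, -⟩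
    · refine (achieves_raiseProgram hL (hx.le_sum.trans (hx.sum_le hK hlam)) hx.weight_le hs h
        hlev).mono le_rfl ?_
      rintro s' _ ⟨h, ⟨h11, hall⟩ | ⟨h11, k, hk⟩⟩
      -- The weights have been raised once more in vain, but the owners are unchanged and `hx` still
      -- speaks of the state before.
      · exact Or.inr ⟨h11, x, h.owner, hx.isEF1 hlam (fair_of_stuck hK hlam hmov hall),
          hx.isPO hlam⟩
      · exact Or.inl ⟨h11, _, _, _, hx.raise hk, h, hx.measure_raise_lt hK hlam hk⟩
    · simp [Expr.eval, h10] at h0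

/-- Iterate until the program has finished. -/
def mainLoop : Program :=
  .loop (.sub (.lit 1) (scalar 11)) iteration

/-- The time of `mainLoop`, with `U` one more than the maximal value of all goods together. -/
def mainTime {R : Type*} [CommSemiring R] (n m U : R) : R :=
  ((n * (4 * U ^ 2 * U) + 1) * ((m * n + 1) * (n * n + 1)) + 1) *
    (iterationTime n m + ((1 + (Expr.sub (.lit 1) (scalar 11)).weight : ℕ) : R))

lemma achieves_mainLoop (hL : Large v (4 * (m * vmax v + 1) ^ 2) L)
    (hlam : IsLogTable (4 * (m * vmax v + 1) ^ 2) (m * vmax v + 1) lam) (hx : Valid v lam x f σ)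
    {s : Memory} (hs : Bounded L s) (h : Holds v lam x f σ s) (h11 : s 11 0 = 0) :
    Achieves L mainLoop (mainTime n m (m * vmax v + 1)) s (Solved v) := by
  -- The rank is the measure plus one, which keeps rank `0` free for the solved state.
  refine (Achieves.loop (T := iterationTime n m) (fun k s =>
    (s 11 0 = 0 ∧ ∃ x f σ, Valid v lam x f σ ∧ Holds v lam x f σ s ∧
      measure v lam (n * (4 * (m * vmax v + 1) ^ 2 * (m * vmax v + 1))) x f σ + 1 = k) ∨
      (s 11 0 = 1 ∧ Solved v s)) ?_ hs (Or.inl ⟨h11, x, f, σ, hx, h, rfl⟩)).mono ?_ ?_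
  · rintro k s hs (⟨h11, x, f, σ, hx, h, rfl⟩ | ⟨h11, -⟩) h0
    · refine (achieves_iteration hL hlam hx hs h).mono le_rfl ?_
      rintro s' _ (⟨h11, x', f', σ', hx', h', hlt⟩ | h')
      · exact ⟨_, Nat.succ_lt_succ hlt, Or.inl ⟨h11, x', f', σ', hx', h', rfl⟩⟩
      · exact ⟨0, Nat.succ_pos _, Or.inr h'⟩
    · simp [Expr.eval, h11] at h0
  · rw [mainTime]
    gcongr ?_ * ?_
    · have := measure_lt (v := v) (lam := lam) (x := x) (f := f) (σ := σ)
        (n * (4 * (m * vmax v + 1) ^ 2 * (m * vmax v + 1)))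
      exact Nat.succ_le_succ this
    · simp
  · rintro s' _ ⟨h0, k, ⟨h11, -⟩ | ⟨-, h⟩⟩
    · simp [Expr.eval, h11] at h0
    · exact h

end MainLoop

/-! ### Initial allocation, logarithm table and total running time -/

section Preparation

variable {n m L : ℕ} {v : Fin n → Fin m → ℕ} {lam : ℕ → ℕ} {x : Allocation n m} {f : Fin n → ℕ}
  {σ : ℕ}

/-- Update the maximal value and give the current good to the current agent if that agent values it
more than its owner. -/
def maximizeBody : Program :=
  .seq (.branch (.sub (entry (scalar 14) (scalar 15)) (scalar 3))
      (.assign 3 (.lit 0) (entry (scalar 14) (scalar 15))) .skip)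
    (.branch (.sub (entry (scalar 14) (scalar 15)) (entry (.read 2 (scalar 15)) (scalar 15)))
      (.assign 2 (scalar 15) (scalar 14)) .skip)

/-- The logarithms are not computed yet, so `Holds` takes whatever array `5` contains as its table.
Maximality of the owners yields validity for any logarithm table later on, by `valid_of_maximal`. -/
lemma achieves_maximize (hL : n * m ≤ L) (hn : 0 < n) (hs : Bounded L (inputMemory v)) :
    Achieves L (pairLoop maximizeBody) (pairTime maximizeBody (n * m)) (inputMemory v) fun s =>
      s 11 0 = 0 ∧ s 3 0 = vmax v ∧ ∃ x : Allocation n m,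
        Holds v (s 5) x (fun _ => 0) 0 s ∧ ∀ a j, v a j ≤ v (x j) j := by
  refine (Achieves.pairLoop (n := n) (m := m) (fun i s => s 11 0 = 0 ∧ s 3 0 ≤ vmax v ∧
    (∀ (a : Fin n) (j : Fin m), (a : ℕ) * m + j < i → v a j ≤ s 3 0) ∧ ∃ x : Allocation n m,
      Holds v (fun _ => 0) x (fun _ => 0) 0 s ∧
      ∀ (a : Fin n) (j : Fin m), (a : ℕ) * m + j < i → v a j ≤ v (x j) j)
    hL ?_ ?_ ?_ hs ?_).mono le_rfl ?_
  · rintro i s ⟨-, -, -, x, h, -⟩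
    exact ⟨h.agents, h.goods⟩
  · rintro i s s' hb ⟨h11, h3, hv, x, h, hx⟩
    have e3 := hb 3 (by decide) (by decide) (by decide)
    exact ⟨by rw [hb 11 (by decide) (by decide) (by decide)]; exact h11, by rwa [e3],
      by rwa [e3], x, h.congr (by simp [hb]), hx⟩
  · rintro a j s hs h12 ha hj ⟨h11, h3, hv, x, h, hx⟩
    have hcond : Expr.eval s (.sub (entry (scalar 14) (scalar 15)) (scalar 3)) = v a j - s 3 0 := by
      simp only [Expr.eval, ha, hj, h.goods, h.entry]
    have hfirst : ∃ s', Bounded L s' ∧ s' 3 0 = max (s 3 0) (v a j) ∧ (∀ b ≠ 3, s' b = s b) ∧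
        s' = Program.exec (.branch (.sub (entry (scalar 14) (scalar 15)) (scalar 3))
          (.assign 3 (.lit 0) (entry (scalar 14) (scalar 15))) .skip) s := by
      refine ⟨_, ?_, ?_, ?_, rfl⟩
      · simp only [Program.exec]
        split_ifs
        · exact hs
        · exact hs.write (hs _ _) _ _
      · simp only [Program.exec, hcond]
        split_ifs with h0
        · omega
        · simp only [Expr.eval, ha, hj, h.goods, h.entry, Memory.write_apply, and_self, if_true]
          omega
      · intro b hb
        simp only [Program.exec]
        split_ifs
        · rfl
        · exact Memory.write_of_ne _ hb _ _
    obtain ⟨s', hs', h3', hb, he⟩ := hfirst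
    have h' : Holds v (fun _ => 0) x (fun _ => 0) 0 s' := h.congr (by simp [hb])
    have ha' : s' 14 0 = a := by rw [hb 14 (by decide), ha]
    have hj' : s' 15 0 = j := by rw [hb 15 (by decide), hj]
    simp only [maximizeBody, Program.Safe]
    rw [Program.exec, ← he]
    refine ⟨⟨⟨fun _ => hs _ _, fun _ => trivial⟩, fun _ => hs' _ _, fun _ => trivial⟩, ?_⟩
    have hv' : ∀ (a' : Fin n) (j' : Fin m), (a' : ℕ) * m + j' < a * m + j + 1 →
        v a' j' ≤ s' 3 0 := by
      intro a' j' hlt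
      rw [h3']
      rcases pair_lt_succ hlt with hlt | ⟨rfl, rfl⟩
      · exact (hv a' j' hlt).trans (le_max_left _ _)
      · exact le_max_right _ _
    have h3'' : s' 3 0 ≤ vmax v := h3' ▸ max_le h3 (le_vmax v a j)
    have h12' : s' 12 0 = a * m + j := by rw [hb 12 (by decide), h12]
    have h11' : s' 11 0 = 0 := by rw [hb 11 (by decide), h11]
    simp only [Program.exec]
    by_cases hc : v a j ≤ v (x j) j
    · rw [if_pos (by simp [Expr.eval, ha', hj', h'.goods, h'.entry, h'.owner]; omega)]
      refine ⟨h12', h11', h3'', hv', x, h', fun a' j' hlt => ?_⟩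
      rcases pair_lt_succ hlt with hlt | ⟨rfl, rfl⟩
      · exact hx a' j' hlt
      · exact hc
    · rw [if_neg (by simp [Expr.eval, ha', hj', h'.goods, h'.entry, h'.owner]; omega)]
      simp only [Expr.eval, ha', hj']
      refine ⟨by simp [Memory.write_apply, h12'], by simpa [Memory.write_apply] using h11',
        by simpa [Memory.write_apply] using h3'', by simpa [Memory.write_apply] using hv',
        _, h'.update a j, fun a' j' hlt => ?_⟩
      rw [Function.update_apply]
      rcases pair_lt_succ hlt with hlt | ⟨rfl, rfl⟩
      · split_ifs with h0
        · subst h0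
          exact (hx a' j' hlt).trans (by omega)
        · exact hx a' j' hlt
      · rw [if_pos rfl]
  -- The zero cells of the input memory already encode a state: agent `0` owns everything, and the
  -- table, the exponents and `σ` vanish.
  · refine ⟨rfl, Nat.zero_le _, by simp, fun _ => ⟨0, hn⟩, ⟨by simp [inputMemory],
      by simp [inputMemory], fun i j => ?_, fun _ => rfl, rfl, fun _ => rfl, rfl⟩, by simp⟩
    have hdiv := pair_div i j
    have hmod : ((i : ℕ) * m + j) % m = j := by
      rw [mul_comm, Nat.mul_add_mod, Nat.mod_eq_of_lt j.2]
    simp only [inputMemory, one_ne_zero, if_false, if_true, pair_lt i j, dif_pos]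
    exact congrArg₂ v (Fin.ext hdiv) (Fin.ext hmod)
  · rintro s _ ⟨h11, h3, hv, x, h, hx⟩
    refine ⟨h11, le_antisymm h3 (Finset.sup_le fun p _ => hv p.1 p.2 (pair_lt _ _)), x, ?_,
      fun a j => hx a j (pair_lt a j)⟩
    rw [h.table]
    exact h

/-- Compute the maximal wealth and the precision, and initialize the powers. -/
def constantsProgram : Program :=
  .seq (.assign 19 (.lit 0) (.add (.mul goods (scalar 3)) (.lit 1)))
    (.seq (.assign 4 (.lit 0) (.mul (.lit 4) (.mul (scalar 19) (scalar 19))))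
      (.seq (.assign 16 (.lit 0) (.lit 0))
        (.seq (.assign 17 (.lit 0) (.lit 1)) (.assign 18 (.lit 0) (.lit 1)))))

/-- Proceed to the next exponent. -/
def exponentBody : Program :=
  .seq (.assign 16 (.lit 0) (.add (scalar 16) (.lit 1)))
    (.seq (.assign 17 (.lit 0) (.mul (scalar 17) (.add (scalar 4) (.lit 1))))
      (.assign 18 (.lit 0) (.mul (scalar 18) (scalar 4))))

/-- A nonzero value means that the exponent can be increased. -/
abbrev exponentTest : Expr :=
  .sub (.add (.lit 1) (.mul (scalar 13) (.mul (scalar 18) (scalar 4))))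
    (.mul (scalar 17) (.add (scalar 4) (.lit 1)))

/-- Compute the table of logarithms. -/
def tableProgram : Program :=
  forLoop 13 (.add (scalar 19) (.lit 1))
    (.seq (.loop exponentTest exponentBody) (.assign 5 (scalar 13) (scalar 16)))

/-- The time of `tableProgram`. -/
def tableTime {R : Type*} [CommSemiring R] (U : R) : R :=
  loopTime (forWeight 13 (.add (scalar 19) (.lit 1))) (U + 1)
    ((4 * U ^ 2 * U + 1) * (((exponentBody.weight + (1 + exponentTest.weight) : ℕ) : R)) +
      (((Program.assign 5 (scalar 13) (scalar 16)).weight : ℕ) : R))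

lemma Holds.write_table {s : Memory} (h : Holds v lam x f σ s) (k w : ℕ) :
    Holds v (s.write 5 k w 5) x f σ (s.write 5 k w) :=
  ⟨h.agents, h.goods, h.entry, h.owner, rfl, h.weight, h.spending⟩

/-- The exponent and the powers that the table computation works with. -/
structure Powers (K U t : ℕ) (s : Memory) (e : ℕ) : Prop where
  precision : s 4 0 = K
  wealth : s 19 0 = U
  exponent : s 16 0 = e
  numerator : s 17 0 = (K + 1) ^ e
  denominator : s 18 0 = K ^ e
  -- The maximum admits the first pass `t = 0` with exponent `0`.
  le : (K + 1) ^ e ≤ max t 1 * K ^ e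

lemma Powers.congr {K U t e : ℕ} {s s' : Memory} (h : Powers K U t s e)
    (hs : ∀ b ∈ [4, 16, 17, 18, 19], s' b = s b) : Powers K U t s' e := by
  simp only [List.mem_cons, List.not_mem_nil, or_false, forall_eq_or_imp, forall_eq] at hs
  obtain ⟨h4, h16, h17, h18, h19⟩ := hs
  exact ⟨h4 ▸ h.precision, h19 ▸ h.wealth, h16 ▸ h.exponent, h17 ▸ h.numerator,
    h18 ▸ h.denominator, h.le⟩

/-- The starting exponent is arbitrary because logarithms increase with `t`, so the search resumes
from the previous entry. `exponent_le` keeps the exponent at most `K * U`, which makes `K * U - e` a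
rank. -/
lemma achieves_exponentLoop {K U t e : ℕ} (hK : 0 < K) (hL : ∀ e ≤ K * U, (K + 1) ^ e < 2 ^ L)
    (hKU : K * U ≤ L) (hU : 0 < U) (htU : t ≤ U) {s : Memory} (hs : Bounded L s) (h11 : s 11 0 = 0)
    (h13 : s 13 0 = t) (h : Holds v lam x f σ s) (hp : Powers K U t s e) :
    Achieves L (.loop exponentTest exponentBody)
      ((K * U + 1) * (exponentBody.weight + (1 + exponentTest.weight))) s fun s' =>
        s' 11 0 = 0 ∧ s' 13 0 = t ∧ Holds v lam x f σ s' ∧ ∃ e, Powers K U t s' e ∧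
          t * K ^ (e + 1) < (K + 1) ^ (e + 1) := by
  have heval : ∀ s e, s 13 0 = t → Powers K U t s e →
      exponentTest.eval s = 1 + t * K ^ (e + 1) - (K + 1) ^ (e + 1) := by
    intro s e h13 hp
    simp only [Expr.eval, h13, hp.precision, hp.numerator, hp.denominator, pow_succ]
  have hle : ∀ e, (K + 1) ^ e ≤ max t 1 * K ^ e → e ≤ K * U := fun e he =>
    (exponent_le hK he).trans (Nat.mul_le_mul_left K (max_le htU hU))
  refine (Achieves.loop (T := exponentBody.weight) (fun k s => s 11 0 = 0 ∧ s 13 0 = t ∧ Holds v lam x f σ s ∧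
    ∃ e, Powers K U t s e ∧ K * U - e = k) ?_ hs ⟨h11, h13, h, e, hp, rfl⟩).mono ?_ ?_
  · rintro k s hs ⟨h11, h13, h, e, hp, rfl⟩ h0
    rw [heval s e h13 hp] at h0
    have h1 : (K + 1) ^ (e + 1) ≤ max t 1 * K ^ (e + 1) :=
      (show (K + 1) ^ (e + 1) ≤ t * K ^ (e + 1) by omega).trans
        (Nat.mul_le_mul_right _ (le_max_left _ _))
    have h2 := hle _ h1
    have h3 := hL _ h2
    have h4 : K ^ (e + 1) ≤ (K + 1) ^ (e + 1) := Nat.pow_le_pow_left (Nat.le_succ K) _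
    have h5 : e + 1 < 2 ^ L := lt_of_le_of_lt (h2.trans hKU) Nat.lt_two_pow_self
    refine Achieves.of_safe hs ?_ ⟨K * U - (e + 1), by omega, ?_, ?_, ?_, e + 1,
      ⟨?_, ?_, ?_, ?_, ?_, h1⟩, rfl⟩
    · rw [pow_succ] at h3
      have h6 := h4.trans_lt (hL _ h2)
      rw [pow_succ] at h6
      simp [exponentBody, Program.Safe, Program.exec, Expr.eval, Memory.write_apply, hp.precision,
        hp.numerator, hp.denominator, hp.exponent, h3, h5, h6]
    · simp [exponentBody, Program.exec, Memory.write_apply, h11]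
    · simp [exponentBody, Program.exec, Memory.write_apply, h13]
    · exact ((h.write (by decide) _ _).write (by decide) _ _).write (by decide) _ _
    · simp [exponentBody, Program.exec, Memory.write_apply, hp.precision]
    · simp [exponentBody, Program.exec, Memory.write_apply, hp.wealth]
    · simp [exponentBody, Program.exec, Expr.eval, Memory.write_apply, hp.exponent]
    · simp [exponentBody, Program.exec, Expr.eval, Memory.write_apply, hp.precision, hp.numerator,
        pow_succ]
    · simp [exponentBody, Program.exec, Expr.eval, Memory.write_apply, hp.precision,
        hp.denominator, pow_succ]
  · gcongr
    exact Nat.sub_le _ _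
  · rintro s' _ ⟨h0, k, h11, h13, h, e, hp, -⟩
    rw [heval s' e h13 hp] at h0
    exact ⟨h11, h13, h, e, hp, by omega⟩

lemma achieves_tableProgram {U : ℕ}
    (hL : ∀ e ≤ 4 * U ^ 2 * U, (4 * U ^ 2 + 1) ^ e < 2 ^ L) (hKU : 4 * U ^ 2 * U ≤ L)
    (hUL : U + 1 ≤ L) (hU : 0 < U) {s : Memory} (hs : Bounded L s) (h11 : s 11 0 = 0)
    (h : Holds v (s 5) x f σ s) (hp : Powers (4 * U ^ 2) U 0 s 0) :
    Achieves L tableProgram (tableTime U) s fun s' => s' 11 0 = 0 ∧ Holds v (s' 5) x f σ s' ∧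
      IsLogTable (4 * U ^ 2) U (s' 5) := by
  have hK : 0 < 4 * U ^ 2 := by positivity
  set K := 4 * U ^ 2
  have key := Achieves.forLoop (c := 13) (bound := .add (scalar 19) (.lit 1))
    (P := .seq (.loop exponentTest exponentBody) (.assign 5 (scalar 13) (scalar 16)))
    (T := (K * U + 1) * (exponentBody.weight + (1 + exponentTest.weight)) +
      (Program.assign 5 (scalar 13) (scalar 16)).weight)
    (N := U + 1) (L := L) (fun t s => s 11 0 = 0 ∧ Holds v (s 5) x f σ s ∧
      (∃ e, Powers K U t s e) ∧ ∀ t', 0 < t' → t' < t →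
        (K + 1) ^ s 5 t' ≤ t' * K ^ s 5 t' ∧ t' * K ^ (s 5 t' + 1) < (K + 1) ^ (s 5 t' + 1))
    (hUL.trans_lt Nat.lt_two_pow_self) ?_ ?_ ?_ hs ⟨h11, h, ⟨0, hp⟩, by simp⟩
  · refine key.mono ?_ ?_
    · simp [tableTime, K]
    · rintro s' _ ⟨h11, h, -, ht⟩
      exact ⟨h11, h, fun t h0 h1 => ht t h0 (Nat.lt_succ_of_le h1)⟩
  · rintro t s ⟨-, -, ⟨e, hp⟩, -⟩
    simp [Expr.eval, hp.wealth]
  · rintro t s w ⟨h11, h, ⟨e, hp⟩, ht⟩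
    exact ⟨by simpa [Memory.write_apply] using h11, h.write (by decide) _ _,
      ⟨e, hp.congr (by simp [Memory.write_of_ne])⟩, ht⟩
  · rintro t htU s hs h13 ⟨h11, h, ⟨e, hp⟩, ht⟩
    generalize hlam : s 5 = lam at h ht
    refine (achieves_exponentLoop hK hL hKU hU (Nat.lt_succ_iff.1 htU) hs h11 h13 h hp).seq ?_
    rintro s hs ⟨h11, h13, h, e, hp, hlt⟩
    refine Achieves.of_safe (P := .assign 5 (scalar 13) (scalar 16)) hs (hs _ _)
      ⟨?_, ?_, ?_, ⟨e, ?_⟩, ?_⟩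
    · simpa [Program.exec, Memory.write_apply] using h13
    · simpa [Program.exec, Memory.write_apply] using h11
    · exact h.write_table _ _
    · have hp' : Powers K U (t + 1) s e := ⟨hp.precision, hp.wealth, hp.exponent, hp.numerator,
        hp.denominator, hp.le.trans (Nat.mul_le_mul_right _ (max_le_max_right 1 (Nat.le_succ t)))⟩
      exact hp'.congr (by simp [Program.exec, Memory.write_of_ne])
    · intro t' h0 h1
      simp only [Program.exec, Expr.eval, Memory.write_apply, h13, hp.exponent, true_and, h.table]
      split_ifs with h2
      · subst h2
        have := hp.le
        rw [max_eq_left h0] at this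
        exact ⟨this, hlt⟩
      · exact ht t' h0 (by omega)

/-- The whole program. -/
def fairProgram : Program :=
  .seq (pairLoop maximizeBody) (.seq constantsProgram (.seq tableProgram mainLoop))

/-- The number of digits of the numbers that occur in `fairProgram`. -/
def digits {R : Type*} [CommSemiring R] (n m U : R) : R :=
  n + m + n * m + U + 4 * U ^ 2 + (n * (4 * U ^ 2 * U) + 1) + 4 * U ^ 2 * (4 * U ^ 2 * U) +
    4 * U ^ 2 * U + 2

/-- A bound on the running time of `fairProgram`. -/
def fairTime {R : Type*} [CommSemiring R] (n m V : R) : R :=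
  (pairTime maximizeBody (n * m) + (((constantsProgram.weight : ℕ) : R) +
    (tableTime (m * V + 1) + mainTime n m (m * V + 1)))) * (digits n m (m * V + 1) + 1)

theorem outputs_fairProgram (v : Fin n → Fin m → ℕ) (hn : 0 < n) :
    ∃ (t : ℕ) (x : Allocation n m), Outputs fairProgram v t x ∧ t ≤ fairTime n m (vmax v) ∧
      IsEF1 v x ∧ IsPO v x := by
  obtain ⟨U, hU⟩ : ∃ U, U = m * vmax v + 1 := ⟨_, rfl⟩
  obtain ⟨L, hLdef⟩ : ∃ L, L = digits n m U := ⟨_, rfl⟩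
  have hU0 : 0 < U := by omega
  have hLn : n ≤ L ∧ m ≤ L ∧ n * m ≤ L ∧ U + 1 ≤ L ∧ 4 * U ^ 2 ≤ L ∧
      n * (4 * U ^ 2 * U) + 1 ≤ L ∧ 4 * U ^ 2 * (4 * U ^ 2 * U) + 1 ≤ L ∧ 4 * U ^ 2 * U ≤ L := by
    rw [hLdef, digits]
    generalize n * (4 * U ^ 2 * U) = a
    generalize 4 * U ^ 2 * (4 * U ^ 2 * U) = b
    generalize 4 * U ^ 2 * U = c
    generalize 4 * U ^ 2 = d
    generalize n * m = e
    omega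
  obtain ⟨hL1, hL2, hL3, hL4, hL5, hL6, hL7, hL8⟩ := hLn
  have small : ∀ k ≤ L, k < 2 ^ L := fun k hk => hk.trans_lt Nat.lt_two_pow_self
  -- From `K + 1 ≤ 2 ^ K` the exact powers have at most about `K * (K * U)` digits, which is
  -- polynomial in `U`; `digits` has a summand for this.
  have hpow : ∀ e ≤ 4 * U ^ 2 * U, (4 * U ^ 2 + 1) ^ e < 2 ^ L := by
    intro e he
    calc (4 * U ^ 2 + 1) ^ e ≤ (2 ^ (4 * U ^ 2)) ^ e :=
          Nat.pow_le_pow_left (Nat.succ_le_of_lt Nat.lt_two_pow_self) e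
      _ = 2 ^ (4 * U ^ 2 * e) := (pow_mul _ _ _).symm
      _ < 2 ^ L := Nat.pow_lt_pow_right (by norm_num)
        (lt_of_le_of_lt (Nat.mul_le_mul_left _ he) hL7)
  have hs : Bounded L (inputMemory v) := by
    intro a k
    apply small
    unfold inputMemory
    split_ifs
    · exact hL1
    · exact hL2
    · exact Nat.zero_le _
    · exact (entry_le v _ _).trans (by omega)
    · exact Nat.zero_le _
    · exact Nat.zero_le _
  have hlarge : Large v (4 * (m * vmax v + 1) ^ 2) L :=
    ⟨hL1, hL2, hL3, by omega, by rw [← hU]; exact hL6⟩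
  have key : Achieves L fairProgram (pairTime maximizeBody (n * m) + (constantsProgram.weight +
      (tableTime U + mainTime n m (m * vmax v + 1)))) (inputMemory v) (Solved v) := by
    refine (achieves_maximize hL3 hn hs).seq fun s hs ⟨h11, h3, x, h, hx⟩ => ?_
    have hconst : Achieves L constantsProgram constantsProgram.weight s fun s' =>
        s' 11 0 = 0 ∧ Holds v (s' 5) x (fun _ => 0) 0 s' ∧ Powers (4 * U ^ 2) U 0 s' 0 := by
      have e1 : m * vmax v + 1 = U := hU.symm
      have e2 : 4 * (U * U) = 4 * U ^ 2 := by ring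
      refine Achieves.of_safe hs ?_ ⟨?_, ?_, ?_, ?_, ?_, ?_, ?_, by simp⟩
      · have h1 := small 1 (by omega)
        have h2 := small U (by omega)
        have h3' := small _ hL5
        simp [constantsProgram, Program.Safe, Program.exec, Expr.eval, Memory.write_apply, h3,
          h.goods, e1, e2, h1, h2, h3']
      · simp [constantsProgram, Program.exec, Memory.write_apply, h11]
      · exact ((((h.write (by decide) _ _).write (by decide) _ _).write (by decide) _ _).write
          (by decide) _ _).write (by decide) _ _
      · simp [constantsProgram, Program.exec, Expr.eval, Memory.write_apply, h3, h.goods, e1, e2]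
      · simp [constantsProgram, Program.exec, Expr.eval, Memory.write_apply, h3, h.goods, e1]
      · simp [constantsProgram, Program.exec, Expr.eval, Memory.write_apply]
      · simp [constantsProgram, Program.exec, Expr.eval, Memory.write_apply]
      · simp [constantsProgram, Program.exec, Expr.eval, Memory.write_apply]
    refine hconst.seq fun s hs ⟨h11, h, hp⟩ => ?_
    refine (achieves_tableProgram hpow hL8 hL4 hU0 hs h11 h hp).seq fun s hs ⟨h11, h, hlam⟩ => ?_
    rw [hU] at hlam
    exact achieves_mainLoop hlarge hlam (valid_of_maximal (by positivity) hlam hx) hs h h11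
  obtain ⟨t, s, hrun, ht, -, x, hx, hEF1, hPO⟩ := key
  refine ⟨t, x, ⟨s, hrun, hx⟩, ht.trans (le_of_eq ?_), hEF1, hPO⟩
  rw [fairTime, hLdef, hU]
  simp

lemma fairTime_mono {V V' : ℕ} (h : V ≤ V') : fairTime n m V ≤ fairTime n m V' := by
  unfold fairTime mainTime tableTime digits loopTime
  gcongr

/-- Only semiring operations and numerals occur in the bound, so evaluating it at polynomials
commutes with evaluating those polynomials at numbers. -/
lemma map_fairTime {R S : Type*} [CommSemiring R] [CommSemiring S] (φ : R →+* S) (a b c : R) :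
    φ (fairTime a b c) = fairTime (φ a) (φ b) (φ c) := by
  simp [fairTime, mainTime, iterationTime, wealthTime, levelTime, moveTime, raiseTime, tableTime,
    digits, pairTime, loopTime, map_ofNat]

end Preparation

end FairDivision

theorem mainTheorem1 :
    ∃ P : FairDivision.Program,
      (∃ p : MvPolynomial (Fin 3) ℕ,
        ∀ (n m : ℕ) (v : Fin n → Fin m → ℕ), 0 < n →
          ∃ (t : ℕ) (x : FairDivision.Allocation n m),
            FairDivision.Outputs P v t x ∧
            t ≤ MvPolynomial.eval ![m, n, FairDivision.vmax v] p ∧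
            FairDivision.IsEF1 v x ∧ FairDivision.IsPO v x) ∧
      (∀ f : MvPolynomial (Fin 2) ℕ, ∃ q : MvPolynomial (Fin 2) ℕ,
        ∀ (n m : ℕ) (v : Fin n → Fin m → ℕ), 0 < n →
          (∀ i j, v i j ≤ MvPolynomial.eval ![m, n] f) →
          ∃ (t : ℕ) (x : FairDivision.Allocation n m),
            FairDivision.Outputs P v t x ∧
            t ≤ MvPolynomial.eval ![m, n] q ∧
            FairDivision.IsEF1 v x ∧ FairDivision.IsPO v x) := by
  refine ⟨FairDivision.fairProgram,
    -- The variables are ordered `m`, `n`, `vmax v`, whereas `fairTime` takes `n` first. For the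
    -- second claim `f` itself replaces the variable of the maximal value, and monotonicity
    -- finishes.
    ⟨FairDivision.fairTime (.X 1) (.X 0) (.X 2), fun n m v hn => ?_⟩,
    fun f => ⟨FairDivision.fairTime (.X 1) (.X 0) f, fun n m v hn hv => ?_⟩⟩
  · obtain ⟨t, x, h1, h2, h3⟩ := FairDivision.outputs_fairProgram v hn
    refine ⟨t, x, h1, ?_, h3⟩
    rw [FairDivision.map_fairTime]
    simpa using h2
  · obtain ⟨t, x, h1, h2, h3⟩ := FairDivision.outputs_fairProgram v hn
    refine ⟨t, x, h1, h2.trans ?_, h3⟩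
    rw [FairDivision.map_fairTime]
    have hle : FairDivision.vmax v ≤ MvPolynomial.eval ![m, n] f :=
      Finset.sup_le fun p _ => hv p.1 p.2
    simpa using FairDivision.fairTime_mono hle
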